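/- Let $\mathcal M=(M,\nabla)$ be an affine manifold: $M$ is a connected smooth (Hausdorff, finite-dimensional) manifold without boundary and $\nabla$ is a smooth torsion-free connection on $TM$. Let $R(X,Y)=\nabla_X\nabla_Y-\nabla_Y\nabla_X-\nabla_{[X,Y]}$ be its curvature operator, and suppose that $\mathcal M$ is locally symmetric, that is, $\nabla R=0$. Let $\rho(x,y)=\operatorname{Tr}\{z\mapsto R(z,x)y\}$ be the Ricci tensor and $\rho_s(x,y)=\tfrac12\{\rho(x,y)+\rho(y,x)\}$ the symmetric Ricci tensor. 1. $\mathcal M$ is locally affine homogeneous: for any two points $P,Q\in M$ there is a diffeomorphism $\phi$ from an open neighborhood of $P$ onto an open neighborhood of $Q$ with $\phi(P)=Q$ that intertwines $\nabla$ with itself, i.e. $\phi_*(\nabla_XY)=\nabla_{\phi_*X}\,\phi_*Y$. 2. If $\rho_s$ is nondegenerate at every point of $M$, then $\rho_s$ is a smooth pseudo-Riemannian metric, $\nabla$ is its Levi-Civita connection (i.e. $\nabla$ is torsion free and $\nabla\rho_s=0$), and $(M,\rho_s)$ is a locally symmetric pseudo-Riemannian manifold, i.e. the curvature of the Levi-Civita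 connection of $\rho_s$ is parallel. -/

import Mathlib

open Bundle VectorField
open scoped Manifold ContDiff Topology

noncomputable section

namespace AffineGeometry

set_option linter.unusedSectionVars false

variable {E : Type*} [NormedAddCommGroup E] [NormedSpace ℝ E]
  {M : Type*} [TopologicalSpace M] [ChartedSpace E M]

/-- A smooth (`C^∞`) vector field on `M`. -/
def IsSmoothField [IsManifold 𝓘(ℝ, E) ∞ M] (X : Π x : M, TangentSpace 𝓘(ℝ, E) x) : Prop :=
  ContMDiff 𝓘(ℝ, E) 𝓘(ℝ, E).tangent ∞ fun x ↦ (⟨x, X x⟩ : TangentBundle 𝓘(ℝ, E) M)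

variable (E M) in
/-- A connection on the tangent bundle of `M`; `cov Y x (X x)` is `(∇_X Y)(x)`. -/
abbrev Connection [IsManifold 𝓘(ℝ, E) ∞ M] :=
  CovariantDerivative 𝓘(ℝ, E) E (TangentSpace 𝓘(ℝ, E) : M → Type _)

/-- A smooth connection: it takes smooth vector fields to smooth sections. -/
abbrev IsSmoothConnection [IsManifold 𝓘(ℝ, E) ∞ M] (cov : Connection E M) : Prop :=
  CovariantDerivative.ContMDiffCovariantDerivative cov ∞

/-- The curvature operator on vector fields:
`R(X, Y) Z = ∇_X ∇_Y Z - ∇_Y ∇_X Z - ∇_[X, Y] Z`. -/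
def curvatureField [IsManifold 𝓘(ℝ, E) ∞ M] (cov : Connection E M)
    (X Y Z : Π x : M, TangentSpace 𝓘(ℝ, E) x) (x : M) : TangentSpace 𝓘(ℝ, E) x :=
  cov (fun y ↦ cov Z y (Y y)) x (X x) - cov (fun y ↦ cov Z y (X y)) x (Y x)
    - cov Z x (mlieBracket 𝓘(ℝ, E) X Y x)

section tensor

variable [FiniteDimensional ℝ E] [T2Space M] [IsManifold 𝓘(ℝ, E) ∞ M]

theorem IsSmoothField.mdifferentiableAt {X : Π x : M, TangentSpace 𝓘(ℝ, E) x}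
    (hX : IsSmoothField X) (x : M) : MDiffAt (T% X) x :=
  (hX x).mdifferentiableAt (by simp)

theorem IsSmoothField.add {X Y : Π x : M, TangentSpace 𝓘(ℝ, E) x}
    (hX : IsSmoothField X) (hY : IsSmoothField Y) : IsSmoothField (X + Y) :=
  ContMDiff.add_section hX hY

theorem IsSmoothField.smul {X : Π x : M, TangentSpace 𝓘(ℝ, E) x} {f : M → ℝ}
    (hX : IsSmoothField X) (hf : ContMDiff 𝓘(ℝ, E) 𝓘(ℝ, ℝ) ∞ f) : IsSmoothField (f • X) :=
  ContMDiff.smul_section hf hX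

theorem IsSmoothField.cov {cov : Connection E M} (h : IsSmoothConnection cov)
    {Y Z : Π x : M, TangentSpace 𝓘(ℝ, E) x} (hY : IsSmoothField Y) (hZ : IsSmoothField Z) :
    IsSmoothField fun x ↦ cov Z x (Y x) := by
  have h1 := h.contMDiff.contMDiff (σ := Z) (by
    rw [contMDiffOn_univ]; exact hZ)
  rw [contMDiffOn_univ] at h1
  exact h1.clm_bundle_apply hY

/-- A tangent vector at `x`, extended to a global smooth vector field: constant in the chart
at `x`, multiplied by a bump function which is `1` near `x`. -/
def extendField {x : M} (v : TangentSpace 𝓘(ℝ, E) x) (y : M) : TangentSpace 𝓘(ℝ, E) y :=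
  (Classical.arbitrary (SmoothBumpFunction 𝓘(ℝ, E) x)) y •
    (trivializationAt E (TangentSpace 𝓘(ℝ, E)) x).symmₗ ℝ y
      ((trivializationAt E (TangentSpace 𝓘(ℝ, E)) x).linearMapAt ℝ x v)

theorem extendField_self {x : M} (v : TangentSpace 𝓘(ℝ, E) x) : extendField v x = v := by
  simp only [extendField, SmoothBumpFunction.eq_one, one_smul]
  exact Trivialization.symmₗ_linearMapAt _ (FiberBundle.mem_baseSet_trivializationAt' x) v

theorem extendField_smooth {x : M} (v : TangentSpace 𝓘(ℝ, E) x) :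
    IsSmoothField (extendField v) := by
  set χ := Classical.arbitrary (SmoothBumpFunction 𝓘(ℝ, E) x) with hχ
  set t := trivializationAt E (TangentSpace 𝓘(ℝ, E)) x with ht
  refine ContMDiffOn.smul_section_of_tsupport (u := t.baseSet) (F := E) (ψ := χ)
    (s := fun y ↦ t.symmₗ ℝ y (t.linearMapAt ℝ x v))
    χ.contMDiff.contMDiffOn t.open_baseSet ?_ ?_
  · exact χ.tsupport_subset_chartAt_source
  · intro y hy
    rw [t.contMDiffWithinAt_section _ hy]
    refine (contMDiffOn_const (c := t.linearMapAt ℝ x v)).congr (fun z hz ↦ ?_) y hy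
    simp [t.symmₗ_apply hz, t.apply_mk_symm hz]

theorem extendField_add {x : M} (v w : TangentSpace 𝓘(ℝ, E) x) :
    extendField (v + w) = extendField v + extendField w := by
  ext y
  simp [extendField]

theorem extendField_smul {x : M} (a : ℝ) (v : TangentSpace 𝓘(ℝ, E) x) :
    extendField (a • v) = (fun _ : M ↦ a) • extendField v := by
  ext y
  simp [extendField, smul_comm a]

variable {cov : Connection E M}
variable {X X' Y Y' Z Z' : Π x : M, TangentSpace 𝓘(ℝ, E) x} {f : M → ℝ}

theorem cov_add (cov : Connection E M) (hX : IsSmoothField X) (hY : IsSmoothField Y) (x : M) :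
    cov (X + Y) x = cov X x + cov Y x :=
  cov.isCovariantDerivativeOnUniv.add (hX.mdifferentiableAt x) (hY.mdifferentiableAt x)

theorem cov_smul (cov : Connection E M) (hX : IsSmoothField X)
    (hf : ContMDiff 𝓘(ℝ, E) 𝓘(ℝ, ℝ) ∞ f) (x : M) :
    cov (f • X) x = f x • cov X x + (mvfderiv 𝓘(ℝ, E) f x).smulRight (X x) :=
  cov.isCovariantDerivativeOnUniv.leibniz (hX.mdifferentiableAt x)
    ((hf x).mdifferentiableAt (by simp))

theorem curvatureField_add_left (hcov : IsSmoothConnection cov) (hX : IsSmoothField X)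
    (hX' : IsSmoothField X') (hZ : IsSmoothField Z) (x : M) :
    curvatureField cov (X + X') Y Z x = curvatureField cov X Y Z x + curvatureField cov X' Y Z x := by
  have h : (fun y ↦ cov Z y ((X + X') y)) = (fun y ↦ cov Z y (X y)) + fun y ↦ cov Z y (X' y) := by
    ext y; simp
  simp only [curvatureField, h, cov_add cov (hX.cov hcov hZ) (hX'.cov hcov hZ),
    mlieBracket_add_left (hX.mdifferentiableAt x) (hX'.mdifferentiableAt x)]
  simp
  abel

theorem curvatureField_swap (cov : Connection E M) (x : M) :
    curvatureField cov Y X Z x = - curvatureField cov X Y Z x := by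
  simp only [curvatureField]
  rw [mlieBracket_swap]
  simp
  abel

theorem curvatureField_add_mid (hcov : IsSmoothConnection cov) (hY : IsSmoothField Y)
    (hY' : IsSmoothField Y') (hZ : IsSmoothField Z) (x : M) :
    curvatureField cov X (Y + Y') Z x = curvatureField cov X Y Z x + curvatureField cov X Y' Z x := by
  rw [← neg_inj, ← curvatureField_swap, curvatureField_add_left hcov hY hY' hZ,
    curvatureField_swap (Y := Y), curvatureField_swap (Y := Y')]
  abel

theorem curvatureField_add_right (hcov : IsSmoothConnection cov) (hX : IsSmoothField X)
    (hY : IsSmoothField Y) (hZ : IsSmoothField Z) (hZ' : IsSmoothField Z') (x : M) :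
    curvatureField cov X Y (Z + Z') x = curvatureField cov X Y Z x + curvatureField cov X Y Z' x := by
  have h (W : Π x : M, TangentSpace 𝓘(ℝ, E) x) : (fun y ↦ cov (Z + Z') y (W y))
      = (fun y ↦ cov Z y (W y)) + fun y ↦ cov Z' y (W y) := by
    ext y; simp [cov_add cov hZ hZ']
  simp only [curvatureField]
  rw [h, h, cov_add cov (hX.cov hcov hZ) (hX.cov hcov hZ'),
    cov_add cov (hY.cov hcov hZ) (hY.cov hcov hZ'), cov_add cov hZ hZ']
  simp
  abel

theorem curvatureField_smul_left (hcov : IsSmoothConnection cov) (hX : IsSmoothField X)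
    (hZ : IsSmoothField Z) (hf : ContMDiff 𝓘(ℝ, E) 𝓘(ℝ, ℝ) ∞ f) (x : M) :
    curvatureField cov (f • X) Y Z x = f x • curvatureField cov X Y Z x := by
  have h : (fun y ↦ cov Z y ((f • X) y)) = f • (fun y ↦ cov Z y (X y)) := by
    ext y; simp
  simp only [curvatureField, h, cov_smul cov (hX.cov hcov hZ) hf,
    mlieBracket_smul_left ((hf x).mdifferentiableAt (by simp)) (hX.mdifferentiableAt x)]
  simp
  module

theorem curvatureField_smul_mid (hcov : IsSmoothConnection cov) (hY : IsSmoothField Y)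
    (hZ : IsSmoothField Z) (hf : ContMDiff 𝓘(ℝ, E) 𝓘(ℝ, ℝ) ∞ f) (x : M) :
    curvatureField cov X (f • Y) Z x = f x • curvatureField cov X Y Z x := by
  rw [← neg_inj, ← curvatureField_swap, curvatureField_smul_left hcov hY hZ hf,
    curvatureField_swap (Y := Y)]
  simp

theorem curvatureField_const_smul_right (hcov : IsSmoothConnection cov) (hX : IsSmoothField X)
    (hY : IsSmoothField Y) (hZ : IsSmoothField Z) (a : ℝ) (x : M) :
    curvatureField cov X Y ((fun _ : M ↦ a) • Z) x = a • curvatureField cov X Y Z x := by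
  have h0 {Z : Π x : M, TangentSpace 𝓘(ℝ, E) x} (hZ : IsSmoothField Z) (x : M) :
      cov ((fun _ : M ↦ a) • Z) x = a • cov Z x := by
    exact cov.isCovariantDerivativeOnUniv.smul_const a (hZ.mdifferentiableAt x)
  have h (W : Π x : M, TangentSpace 𝓘(ℝ, E) x) : (fun y ↦ cov ((fun _ : M ↦ a) • Z) y (W y))
      = (fun _ : M ↦ a) • (fun y ↦ cov Z y (W y)) := by
    ext y; simp [h0 hZ]
  simp only [curvatureField]
  rw [h, h, h0 (hX.cov hcov hZ), h0 (hY.cov hcov hZ), h0 hZ]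
  simp
  module

/-- The curvature tensor: `curvature hcov x u v w = R(u, v) w` for tangent vectors at `x`. -/
def curvature (hcov : IsSmoothConnection cov) (x : M) :
    TangentSpace 𝓘(ℝ, E) x →ₗ[ℝ] TangentSpace 𝓘(ℝ, E) x →ₗ[ℝ]
      TangentSpace 𝓘(ℝ, E) x →ₗ[ℝ] TangentSpace 𝓘(ℝ, E) x :=
  LinearMap.mk₂ ℝ
    (fun u v ↦
      { toFun := fun w ↦
          curvatureField cov (extendField u) (extendField v) (extendField w) x
        map_add' := fun w w' ↦ by
          rw [extendField_add]
          exact curvatureField_add_right hcov (extendField_smooth u) (extendField_smooth v)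
            (extendField_smooth w) (extendField_smooth w') x
        map_smul' := fun a w ↦ by
          rw [extendField_smul]
          exact curvatureField_const_smul_right hcov (extendField_smooth u)
            (extendField_smooth v) (extendField_smooth w) a x })
    (fun u u' v ↦ by
      ext w
      simp only [extendField_add, LinearMap.coe_mk, AddHom.coe_mk, LinearMap.add_apply]
      exact curvatureField_add_left hcov (extendField_smooth u) (extendField_smooth u')
        (extendField_smooth w) x)
    (fun a u v ↦ by
      ext w
      simp only [extendField_smul, LinearMap.coe_mk, AddHom.coe_mk, LinearMap.smul_apply]
      exact curvatureField_smul_left hcov (extendField_smooth u) (extendField_smooth w)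
        contMDiff_const x)
    (fun u v v' ↦ by
      ext w
      simp only [extendField_add, LinearMap.coe_mk, AddHom.coe_mk, LinearMap.add_apply]
      exact curvatureField_add_mid hcov (extendField_smooth v) (extendField_smooth v')
        (extendField_smooth w) x)
    (fun a u v ↦ by
      ext w
      simp only [extendField_smul, LinearMap.coe_mk, AddHom.coe_mk, LinearMap.smul_apply]
      exact curvatureField_smul_mid hcov (extendField_smooth v) (extendField_smooth w)
        contMDiff_const x)

/-- The Ricci tensor `ρ(u, v) = Tr {z ↦ R(z, u) v}`. -/
def ricci (hcov : IsSmoothConnection cov) (x : M) :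
    LinearMap.BilinForm ℝ (TangentSpace 𝓘(ℝ, E) x) :=
  LinearMap.mk₂ ℝ
    (fun u v ↦ LinearMap.trace ℝ (TangentSpace 𝓘(ℝ, E) x)
      (((curvature hcov x).flip u).flip v))
    (fun u u' v ↦ by rw [← map_add]; congr 1; ext z; simp)
    (fun a u v ↦ by rw [← map_smul]; congr 1; ext z; simp)
    (fun u v v' ↦ by rw [← map_add]; congr 1; ext z; simp)
    (fun a u v ↦ by rw [← map_smul]; congr 1; ext z; simp)

/-- The symmetric Ricci tensor `ρ_s(u, v) = (ρ(u, v) + ρ(v, u)) / 2`. -/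
def symRicci (hcov : IsSmoothConnection cov) (x : M) :
    LinearMap.BilinForm ℝ (TangentSpace 𝓘(ℝ, E) x) :=
  (1 / 2 : ℝ) • (ricci hcov x + (ricci hcov x).flip)

end tensor

section geometry

variable [IsManifold 𝓘(ℝ, E) ∞ M]

/-- The torsion `∇_X Y - ∇_Y X - [X, Y]` of the connection vanishes. -/
def IsTorsionFree [FiniteDimensional ℝ E] (cov : Connection E M) : Prop :=
  haveI : CompleteSpace E := FiniteDimensional.complete ℝ E
  cov.torsion = 0

/-- `∇R = 0`: for all smooth vector fields,
`(∇_W R)(X, Y) Z = ∇_W (R(X, Y) Z) - R(∇_W X, Y) Z - R(X, ∇_W Y) Z - R(X, Y) ∇_W Z`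
vanishes. -/
def IsLocallySymmetric (cov : Connection E M) : Prop :=
  ∀ W X Y Z : Π x : M, TangentSpace 𝓘(ℝ, E) x,
    IsSmoothField W → IsSmoothField X → IsSmoothField Y → IsSmoothField Z →
    ∀ x, cov (curvatureField cov X Y Z) x (W x)
      - curvatureField cov (fun y ↦ cov X y (W y)) Y Z x
      - curvatureField cov X (fun y ↦ cov Y y (W y)) Z x
      - curvatureField cov X Y (fun y ↦ cov Z y (W y)) x = 0

/-- A local diffeomorphism `φ`, from an open subset of `M` onto an open subset of `M`, is affine
if it is smooth in both directions and intertwines the connection with itself: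
`φ_* (∇_u (φ^* Y)) = ∇_{φ_* u} Y` for each vector field `Y`, differentiable at `φ x`, and each
tangent vector `u` at a point `x` of the domain of `φ`. -/
def IsLocalAffineMorphism (cov : Connection E M) (φ : OpenPartialHomeomorph M M) : Prop :=
  ContMDiffOn 𝓘(ℝ, E) 𝓘(ℝ, E) ∞ φ φ.source ∧
  ContMDiffOn 𝓘(ℝ, E) 𝓘(ℝ, E) ∞ φ.symm φ.target ∧
  ∀ x ∈ φ.source, ∀ Y : Π y : M, TangentSpace 𝓘(ℝ, E) y,
    MDifferentiableAt 𝓘(ℝ, E) 𝓘(ℝ, E).tangent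
      (fun y ↦ (⟨y, Y y⟩ : TangentBundle 𝓘(ℝ, E) M)) (φ x) →
    ∀ u : TangentSpace 𝓘(ℝ, E) x,
      mfderiv 𝓘(ℝ, E) 𝓘(ℝ, E) φ x (cov (mpullback 𝓘(ℝ, E) 𝓘(ℝ, E) φ Y) x u) =
        cov Y (φ x) (mfderiv 𝓘(ℝ, E) 𝓘(ℝ, E) φ x u)

/-- Local affine homogeneity: any point can be moved to any other one by (the germ of) an affine
local diffeomorphism. -/
def IsLocallyAffineHomogeneous (cov : Connection E M) : Prop :=
  ∀ P Q : M, ∃ φ : OpenPartialHomeomorph M M,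
    P ∈ φ.source ∧ φ P = Q ∧ IsLocalAffineMorphism cov φ

/-- A pseudo-Riemannian metric: a smooth field of nondegenerate symmetric bilinear forms on the
tangent spaces. -/
structure IsPseudoRiemannianMetric
    (g : ∀ x : M, LinearMap.BilinForm ℝ (TangentSpace 𝓘(ℝ, E) x)) : Prop where
  symm : ∀ x, (g x).IsSymm
  nondegenerate : ∀ x, (g x).Nondegenerate
  smooth : ∀ X Y : Π x : M, TangentSpace 𝓘(ℝ, E) x, IsSmoothField X → IsSmoothField Y →
    ContMDiff 𝓘(ℝ, E) 𝓘(ℝ, ℝ) ∞ fun x ↦ g x (X x) (Y x)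

/-- `cov` is the Levi-Civita connection of `g`: it is smooth, torsion free and metric,
`W g(X, Y) = g(∇_W X, Y) + g(X, ∇_W Y)`. -/
structure IsLeviCivita [FiniteDimensional ℝ E]
    (g : ∀ x : M, LinearMap.BilinForm ℝ (TangentSpace 𝓘(ℝ, E) x))
    (cov : Connection E M) : Prop where
  smooth : IsSmoothConnection cov
  torsionFree : IsTorsionFree cov
  metric : ∀ W X Y : Π x : M, TangentSpace 𝓘(ℝ, E) x,
    IsSmoothField W → IsSmoothField X → IsSmoothField Y →
    ∀ x, mvfderiv 𝓘(ℝ, E) (fun y ↦ g y (X y) (Y y)) x (W x) =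
      g x (cov X x (W x)) (Y x) + g x (X x) (cov Y x (W x))

/-- A pseudo-Riemannian metric which is locally symmetric: it has a Levi-Civita connection, and
the curvature of the Levi-Civita connection is parallel. -/
structure IsLocallySymmetricMetric [FiniteDimensional ℝ E]
    (g : ∀ x : M, LinearMap.BilinForm ℝ (TangentSpace 𝓘(ℝ, E) x)) : Prop where
  isMetric : IsPseudoRiemannianMetric g
  exists_leviCivita : ∃ cov : Connection E M, IsLeviCivita g cov
  parallel : ∀ cov : Connection E M, IsLeviCivita g cov → IsLocallySymmetric cov

end geometry
end AffineGeometry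
end

/-!
Local homogeneity is the local Cartan theorem. Since `∇R = 0`, parallel transport matches the
curvature tensors at nearby points, so by connectedness (`sameCurvature`) any two tangent spaces
`T_P M` and `T_Q M` are related by a linear isomorphism `A₀` which intertwines the curvatures. In
coordinates, a map `y` with derivative `A` is affine if and only if it solves the total
differential system

  `D y = A`,  `D A (h) = A ∘ Γ₁(h) - Γ₂(A h) ∘ A`.

The integrability condition of this system at a point says that the connections are torsion-free
and that `A` intertwines the curvatures there (`isIntegrableAt_affineSystem`). A solution along a
ray transports the intertwining property from the origin, since the intertwining defect solves a
homogeneous linear equation (`intertwiningDefect_eq_zero_of_transport`). So the system is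
integrable along every radial solution with initial value `A₀`, and this suffices for the endpoints
of the radial solutions to form a solution (`hasFDerivAt_of_isRadialSolution`, a version of the
Frobenius theorem in which integrability is only known along the solution itself). The inverse
function theorem turns the solution into a local diffeomorphism, and differentiating
`A Z = Y ∘ y` shows that it intertwines the connections (`isLocalAffineMorphism_chartConj`).

For the second part, the Ricci tensor is a contraction of `R`; as the trace of a commutator is zero,
it is parallel as well (`IsSymmetricChristoffel.traceForm_fderiv`), and hence so is its
symmetrization. This is the metric identity for `ρ_s`. The given connection is then the only
Levi-Civita connection of `ρ_s` (`IsLeviCivita.eq_on_smooth`), and its curvature is parallel by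
hypothesis.
-/

noncomputable section

set_option maxSynthPendingDepth 3
set_option linter.unusedSectionVars false

namespace AffineGeometry

/-! ### Total differential systems -/

section TotalDifferential

open Metric Set

variable {E W : Type*} [NormedAddCommGroup E] [NormedSpace ℝ E]
  [NormedAddCommGroup W] [NormedSpace ℝ W]

/-- Uniform bounds for `G` up to second order on the closed ball of radius `r` around `p₀`. -/
structure TaylorBounds {X Y : Type*} [NormedAddCommGroup X] [NormedSpace ℝ X]
    [NormedAddCommGroup Y] [NormedSpace ℝ Y] (G : X → Y) (p₀ : X) (r L K C : ℝ) : Prop where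
  r_pos : 0 < r
  L_nonneg : 0 ≤ L
  K_nonneg : 0 ≤ K
  C_nonneg : 0 ≤ C
  norm_le : ∀ p ∈ closedBall p₀ r, ‖G p‖ ≤ L
  differentiableAt : ∀ p ∈ closedBall p₀ r, DifferentiableAt ℝ G p
  norm_fderiv_le : ∀ p ∈ closedBall p₀ r, ‖fderiv ℝ G p‖ ≤ K
  norm_taylor_le : ∀ p ∈ closedBall p₀ r, ∀ q ∈ closedBall p₀ r,
    ‖G q - G p - fderiv ℝ G p (q - p)‖ ≤ C * ‖q - p‖ ^ 2

theorem TaylorBounds.norm_sub_le {X Y : Type*} [NormedAddCommGroup X] [NormedSpace ℝ X]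
    [NormedAddCommGroup Y] [NormedSpace ℝ Y] {G : X → Y} {p₀ : X} {r L K C : ℝ}
    (hG : TaylorBounds G p₀ r L K C) {p q : X} (hp : p ∈ closedBall p₀ r)
    (hq : q ∈ closedBall p₀ r) : ‖G q - G p‖ ≤ K * ‖q - p‖ :=
  (convex_closedBall p₀ r).norm_image_sub_le_of_norm_fderiv_le hG.differentiableAt
    hG.norm_fderiv_le hp hq

theorem exists_taylorBounds {X Y : Type*} [NormedAddCommGroup X] [NormedSpace ℝ X]
    [NormedAddCommGroup Y] [NormedSpace ℝ Y] {G : X → Y} {p₀ : X}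
    (hG : ContDiffAt ℝ 2 G p₀) {N : Set X} (hN : N ∈ 𝓝 p₀) :
    ∃ r L K C, TaylorBounds G p₀ r L K C ∧ closedBall p₀ r ⊆ N := by
  have h1 : ∀ᶠ p in 𝓝 p₀, DifferentiableAt ℝ G p :=
    (hG.eventually (by simp)).mono fun p hp ↦ hp.differentiableAt (by simp)
  obtain ⟨C, t, ht, hC⟩ := (hG.fderiv_right (m := 1) (by norm_num)).exists_lipschitzOnWith
  obtain ⟨r, hr, hball⟩ := nhds_basis_closedBall.mem_iff.1
    (Filter.inter_mem hN (Filter.inter_mem h1 ht))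
  have hp₀ : p₀ ∈ closedBall p₀ r := mem_closedBall_self hr.le
  have hd : ∀ p ∈ closedBall p₀ r, DifferentiableAt ℝ G p := fun p hp ↦ (hball hp).2.1
  have hL : ∀ p ∈ closedBall p₀ r, ∀ q ∈ closedBall p₀ r,
      ‖fderiv ℝ G q - fderiv ℝ G p‖ ≤ C * ‖q - p‖ := fun p hp q hq ↦ by
    simpa [dist_eq_norm] using hC.dist_le_mul q (hball hq).2.2 p (hball hp).2.2
  have hK : ∀ p ∈ closedBall p₀ r, ‖fderiv ℝ G p‖ ≤ ‖fderiv ℝ G p₀‖ + C * r := fun p hp ↦ by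
    have := hL p₀ hp₀ p hp
    have h2 : ‖p - p₀‖ ≤ r := by simpa [dist_eq_norm] using hp
    calc ‖fderiv ℝ G p‖ ≤ ‖fderiv ℝ G p₀‖ + ‖fderiv ℝ G p - fderiv ℝ G p₀‖ :=
          norm_le_insert' _ _
      _ ≤ _ := by gcongr; exact this.trans (by gcongr)
  refine ⟨r, ‖G p₀‖ + (‖fderiv ℝ G p₀‖ + C * r) * r, ‖fderiv ℝ G p₀‖ + C * r, C,
    ⟨hr, by positivity, by positivity, by positivity, fun p hp ↦ ?_, hd, hK,
      fun p hp q hq ↦ ?_⟩, fun p hp ↦ (hball hp).1⟩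
  · have h2 : ‖p - p₀‖ ≤ r := by simpa [dist_eq_norm] using hp
    have := (convex_closedBall p₀ r).norm_image_sub_le_of_norm_fderiv_le hd hK hp₀ hp
    calc ‖G p‖ ≤ ‖G p₀‖ + ‖G p - G p₀‖ := norm_le_insert' _ _
      _ ≤ _ := by gcongr; exact this.trans (by gcongr)
  · have hseg : segment ℝ p q ⊆ closedBall p₀ r := (convex_closedBall p₀ r).segment_subset hp hq
    have := (convex_segment p q).norm_image_sub_le_of_norm_fderiv_le' (𝕜 := ℝ) (f := G)
      (φ := fderiv ℝ G p) (C := C * ‖q - p‖) (fun z hz ↦ hd z (hseg hz))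
      (fun z hz ↦ (hL p hp z (hseg hz)).trans (by
        gcongr
        obtain ⟨a, b, ha, hb, hab, rfl⟩ := hz
        have : a • p + b • q - p = b • (q - p) := by
          rw [eq_sub_iff_add_eq.2 hab]; module
        rw [this, norm_smul, Real.norm_of_nonneg hb]
        exact mul_le_of_le_one_left (norm_nonneg _) (by linarith)))
      (left_mem_segment ℝ p q) (right_mem_segment ℝ p q)
    simpa [pow_two, mul_assoc] using this

variable {G : E × W → E →L[ℝ] W} {u₀ : W} {r L K C : ℝ}

/-- `u` solves the total differential system `D w = G (x, w)`, `w 0 = u₀`, along the ray from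
`0` to `x`, parametrized by `[0, 1]`, without leaving the ball of radius `r`. -/
structure IsRadialSolution (G : E × W → E →L[ℝ] W) (u₀ : W) (r : ℝ) (x : E) (u : ℝ → W) :
    Prop where
  init : u 0 = u₀
  hasDerivWithinAt : ∀ t ∈ Icc (0 : ℝ) 1,
    HasDerivWithinAt u (G (t • x, u t) x) (Icc 0 1) t
  mem : ∀ t ∈ Icc (0 : ℝ) 1, (t • x, u t) ∈ closedBall ((0 : E), u₀) r

theorem IsRadialSolution.continuousOn {x : E} {u : ℝ → W} (hu : IsRadialSolution G u₀ r x u) :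
    ContinuousOn u (Icc 0 1) := fun t ht ↦ (hu.hasDerivWithinAt t ht).continuousWithinAt

theorem IsRadialSolution.hasDerivWithinAt_Ici {x : E} {u : ℝ → W}
    (hu : IsRadialSolution G u₀ r x u) {t : ℝ} (ht : t ∈ Ico (0 : ℝ) 1) :
    HasDerivWithinAt u (G (t • x, u t) x) (Ici t) t :=
  (hu.hasDerivWithinAt t (Ico_subset_Icc_self ht)).mono_of_mem_nhdsWithin
    (Icc_mem_nhdsGE_of_mem ht)

/-- Radial solutions exist on all of `[0, 1]` once the endpoint is close to `0`: the Picard-Lindelöf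
theorem, applied to a field which is small together with the endpoint. -/
theorem exists_isRadialSolution [CompleteSpace W] (hG : TaylorBounds G (0, u₀) r L K C) :
    ∃ ε > 0, ∀ x ∈ ball (0 : E) ε, ∃ u, IsRadialSolution G u₀ r x u := by
  have hr := hG.r_pos
  have hL := hG.L_nonneg
  have hK := hG.K_nonneg
  refine ⟨min r (r / (L + 1)), by positivity, fun x hx ↦ ?_⟩
  have hx1 : ‖x‖ < r := by simp at hx; exact hx.1
  have hx2 : L * ‖x‖ ≤ r := by
    have : ‖x‖ < r / (L + 1) := by simp at hx; exact hx.2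
    rw [lt_div_iff₀ (by positivity)] at this
    nlinarith [norm_nonneg x]
  have hmem : ∀ t ∈ Icc (0 : ℝ) 1, ∀ w ∈ closedBall u₀ r,
      (t • x, w) ∈ closedBall ((0 : E), u₀) r := fun t ht w hw ↦ by
    rw [← closedBall_prod_same]
    refine ⟨?_, hw⟩
    simp only [mem_closedBall, dist_zero_right, norm_smul, Real.norm_of_nonneg ht.1]
    exact (mul_le_of_le_one_left (norm_nonneg _) ht.2).trans hx1.le
  obtain ⟨r', hr'⟩ : ∃ r' : NNReal, (r' : ℝ) = r := ⟨⟨r, hr.le⟩, rfl⟩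
  obtain ⟨L', hL'⟩ : ∃ L' : NNReal, (L' : ℝ) = L * ‖x‖ := ⟨⟨L * ‖x‖, by positivity⟩, rfl⟩
  obtain ⟨K', hK'⟩ : ∃ K' : NNReal, (K' : ℝ) = K * ‖x‖ := ⟨⟨K * ‖x‖, by positivity⟩, rfl⟩
  obtain ⟨t₀, ht₀⟩ : ∃ t₀ : Icc (0 : ℝ) 1, (t₀ : ℝ) = 0 := ⟨⟨0, by simp⟩, rfl⟩
  have hpl : IsPicardLindelof (fun t w ↦ G (t • x, w) x) t₀ u₀ r' 0 L' K' := by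
    refine ⟨fun t ht ↦ ?_, fun w hw t ht ↦ ?_, fun t ht w hw ↦ ?_, ?_⟩
    · refine LipschitzOnWith.of_dist_le_mul fun w hw w' hw' ↦ ?_
      rw [hr'] at hw hw'
      rw [dist_eq_norm, dist_eq_norm, ← sub_apply]
      refine (ContinuousLinearMap.le_opNorm _ _).trans ?_
      have := hG.norm_sub_le (hmem t ht w' hw') (hmem t ht w hw)
      simp only [Prod.mk_sub_mk, sub_self, Prod.norm_mk, norm_zero,
        max_eq_right (norm_nonneg _)] at this
      calc _ ≤ K * ‖w - w'‖ * ‖x‖ := by gcongr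
        _ = _ := by rw [hK']; ring
    · rw [hr'] at hw
      have := (hG.differentiableAt _ (hmem t ht w hw)).continuousAt
      have h2 : ContinuousAt (fun s : ℝ ↦ G (s • x, w)) t :=
        ContinuousAt.comp (f := fun s : ℝ ↦ (s • x, w)) this (by fun_prop)
      exact (h2.clm_apply continuousAt_const).continuousWithinAt
    · rw [hr'] at hw
      refine (ContinuousLinearMap.le_opNorm _ _).trans ?_
      have := hG.norm_le _ (hmem t ht w hw)
      rw [hL']
      gcongr
    · simpa [ht₀, hr', hL'] using hx2
  have hu₀ : u₀ ∈ closedBall u₀ ((0 : NNReal) : ℝ) := by simp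
  obtain ⟨α, hα⟩ := ODE.FunSpace.exists_isFixedPt_next hpl hu₀
  have hball : ∀ t, α.compProj t ∈ closedBall u₀ r := fun t ↦
    hr' ▸ α.compProj_mem_closedBall hpl.mul_max_le
  refine ⟨α.compProj, ?_, fun t ht ↦ ?_, fun t ht ↦ hmem t ht _ (hball t)⟩
  · have h0 : α.compProj t₀ = u₀ := by
      rw [ODE.FunSpace.compProj_val, ← hα, ODE.FunSpace.next_apply₀]
    rwa [ht₀] at h0
  · apply (ODE.hasDerivWithinAt_picard_Icc (f := fun t w ↦ G (t • x, w) x) (u := closedBall u₀ r')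
      t₀.2 hpl.continuousOn_uncurry
      α.continuous_compProj.continuousOn (fun t' _ ↦ hr' ▸ hball t') u₀ ht).congr_of_mem _ ht
    intro t' ht'
    nth_rw 1 [← hα]
    rw [ODE.FunSpace.compProj_of_mem ht', ODE.FunSpace.next_apply]

theorem gronwallBound_zero_mul (K c s x : ℝ) :
    gronwallBound 0 K (c * s) x = gronwallBound 0 K c x * s := by
  unfold gronwallBound
  split_ifs <;> ring

/-- Radial solutions depend on the endpoint in a Lipschitz way, by Grönwall's inequality. -/
theorem IsRadialSolution.norm_sub_le (hG : TaylorBounds G (0, u₀) r L K C) {x y : E}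
    {u v : ℝ → W} (hu : IsRadialSolution G u₀ r x u) (hv : IsRadialSolution G u₀ r y v)
    (hx : ‖x‖ ≤ r) : ∀ t ∈ Icc (0 : ℝ) 1,
      ‖v t - u t‖ ≤ gronwallBound 0 (K * r) (K * r + L) 1 * ‖y - x‖ := by
  have hr := hG.r_pos
  have hL := hG.L_nonneg
  have hK := hG.K_nonneg
  intro t ht
  have key := norm_le_gronwallBound_of_norm_deriv_right_le (f := fun t ↦ v t - u t)
    (f' := fun t ↦ G (t • y, v t) y - G (t • x, u t) x) (δ := 0) (K := K * r)
    (ε := (K * r + L) * ‖y - x‖) (a := 0) (b := 1)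
    (hv.continuousOn.sub hu.continuousOn)
    (fun t ht ↦ (hv.hasDerivWithinAt_Ici ht).sub (hu.hasDerivWithinAt_Ici ht))
    (by simp [hu.init, hv.init]) (fun s hs ↦ ?_) t ht
  · rw [gronwallBound_zero_mul] at key
    refine key.trans ?_
    gcongr
    exact gronwallBound_mono le_rfl (by positivity) (by positivity) (by linarith [ht.2])
  · have hs' := Ico_subset_Icc_self hs
    have h1 := hG.norm_sub_le (hu.mem s hs') (hv.mem s hs')
    have h2 := hG.norm_le _ (hv.mem s hs')
    have h3 : ‖(s • y, v s) - (s • x, u s)‖ ≤ ‖y - x‖ + ‖v s - u s‖ := by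
      simp only [Prod.mk_sub_mk, Prod.norm_mk, ← smul_sub, norm_smul, Real.norm_of_nonneg hs.1]
      refine max_le ?_ ?_
      · have := mul_le_of_le_one_left (norm_nonneg (y - x)) hs.2.le
        linarith [norm_nonneg (v s - u s)]
      · linarith [norm_nonneg (y - x)]
    have h4 : G (s • y, v s) y - G (s • x, u s) x
        = G (s • y, v s) (y - x) + (G (s • y, v s) - G (s • x, u s)) x := by
      simp
    rw [h4]
    calc _ ≤ ‖G (s • y, v s)‖ * ‖y - x‖ + ‖G (s • y, v s) - G (s • x, u s)‖ * ‖x‖ :=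
          (norm_add_le _ _).trans (add_le_add (ContinuousLinearMap.le_opNorm _ _)
            (ContinuousLinearMap.le_opNorm _ _))
      _ ≤ L * ‖y - x‖ + K * (‖y - x‖ + ‖v s - u s‖) * r := by
          gcongr
          exact h1.trans (by gcongr)
      _ = _ := by ring

/-- The integrability condition at `p` for the total differential system `D w = G (x, w)`: the
second derivative forced on a solution is symmetric. -/
def IsIntegrableAt (G : E × W → E →L[ℝ] W) (p : E × W) : Prop :=
  ∀ h k : E, fderiv ℝ G p (h, G p h) k = fderiv ℝ G p (k, G p k) h

/-- If the system is integrable along the solution over the ray from `0` to `x`, then the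
endpoints of the radial solutions solve the system at `x`: the defect
`u (x + h) t - u x t - t • G (t • x, u x t) h` satisfies a linear differential inequality with an
inhomogeneity of size `‖h‖ ^ 2`. -/
theorem hasFDerivAt_of_isRadialSolution (hG : TaylorBounds G (0, u₀) r L K C) {ε : ℝ}
    (hε : ε ≤ r) {u : E → ℝ → W} (hu : ∀ x ∈ ball (0 : E) ε, IsRadialSolution G u₀ r x (u x))
    {x : E} (hx : x ∈ ball (0 : E) ε)
    (hint : ∀ t ∈ Icc (0 : ℝ) 1, IsIntegrableAt G (t • x, u x t)) :
    HasFDerivAt (fun y ↦ u y 1) (G (x, u x 1)) x := by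
  have hr := hG.r_pos
  have hL := hG.L_nonneg
  have hK := hG.K_nonneg
  have hC := hG.C_nonneg
  set B := 1 + gronwallBound 0 (K * r) (K * r + L) 1 with hB
  have hux := hu x hx
  have hxr : ‖x‖ ≤ r := by simp at hx; linarith
  have hB0 : 0 ≤ gronwallBound 0 (K * r) (K * r + L) 1 := by
    have := gronwallBound_mono (δ := 0) (K := K * r) (ε := K * r + L) le_rfl (by positivity)
      (by positivity) zero_le_one
    simpa [gronwallBound_x0] using this
  have hB1 : 0 ≤ B := by positivity
  set D := K * B + C * B ^ 2 * r with hD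
  have main : ∀ h : E, x + h ∈ ball (0 : E) ε →
      ‖u (x + h) 1 - u x 1 - G (x, u x 1) h‖ ≤ gronwallBound 0 (K * r) D 1 * ‖h‖ ^ 2 := by
    intro h hh
    have hv := hu (x + h) hh
    set v := u (x + h) with hvdef
    have hxh : ‖x + h‖ ≤ r := by simp at hh; linarith
    have hδ : ∀ s ∈ Icc (0 : ℝ) 1, ‖(s • (x + h), v s) - (s • x, u x s)‖ ≤ B * ‖h‖ := by
      intro s hs
      have := hux.norm_sub_le hG hv hxr s hs
      rw [add_sub_cancel_left] at this
      simp only [Prod.mk_sub_mk, Prod.norm_mk, ← smul_sub, norm_smul, Real.norm_of_nonneg hs.1,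
        add_sub_cancel_left]
      have h2 := mul_le_of_le_one_left (norm_nonneg h) hs.2
      have h3 : 0 ≤ gronwallBound 0 (K * r) (K * r + L) 1 * ‖h‖ := by positivity
      refine max_le ?_ ?_ <;> rw [hB] <;> linarith [norm_nonneg h]
    have hGd : ∀ s ∈ Icc (0 : ℝ) 1, HasDerivWithinAt (fun s ↦ G (s • x, u x s))
        (fderiv ℝ G (s • x, u x s) (x, G (s • x, u x s) x)) (Icc 0 1) s := fun s hs ↦ by
      have h1 : HasDerivWithinAt (fun s : ℝ ↦ (s • x, u x s)) (x, G (s • x, u x s) x)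
          (Icc 0 1) s := by
        refine HasDerivWithinAt.prodMk ?_ (hux.hasDerivWithinAt s hs)
        simpa using ((hasDerivAt_id s).smul_const x).hasDerivWithinAt
      exact ((hG.differentiableAt _ (hux.mem s hs)).hasFDerivAt).comp_hasDerivWithinAt s h1
    have hfd : ∀ s ∈ Icc (0 : ℝ) 1, HasDerivWithinAt
        (fun s ↦ v s - u x s - s • G (s • x, u x s) h)
        (G (s • (x + h), v s) (x + h) - G (s • x, u x s) x
          - (s • fderiv ℝ G (s • x, u x s) (x, G (s • x, u x s) x) h
              + (1 : ℝ) • G (s • x, u x s) h)) (Icc 0 1) s := fun s hs ↦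
      ((hv.hasDerivWithinAt s hs).sub (hux.hasDerivWithinAt s hs)).sub
        ((hasDerivWithinAt_id s _).smul (by
          simpa using (hGd s hs).clm_apply (hasDerivWithinAt_const s _ h)))
    have key := norm_le_gronwallBound_of_norm_deriv_right_le
      (f := fun s ↦ v s - u x s - s • G (s • x, u x s) h) (δ := 0) (K := K * r)
      (ε := D * ‖h‖ ^ 2) (a := 0) (b := 1)
      (fun s hs ↦ (hfd s hs).continuousWithinAt)
      (fun s hs ↦ (hfd s (Ico_subset_Icc_self hs)).mono_of_mem_nhdsWithin
        (Icc_mem_nhdsGE_of_mem hs))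
      (by simp [hux.init, hv.init]) (fun s hs ↦ ?_) 1 (by simp)
    · simpa [gronwallBound_zero_mul] using key
    · have hs' := Ico_subset_Icc_self hs
      set p := (s • x, u x s) with hp
      set q := (s • (x + h), v s) with hq
      have hpm : p ∈ closedBall ((0 : E), u₀) r := hux.mem s hs'
      have hqm : q ∈ closedBall ((0 : E), u₀) r := hv.mem s hs'
      have hT := hG.norm_taylor_le p hpm q hqm
      have hqp := hδ s hs'
      have hDp := hG.norm_fderiv_le p hpm
      have hsplit : fderiv ℝ G p (q - p) x = fderiv ℝ G p (0, v s - u x s - s • G p h) x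
          + s • fderiv ℝ G p (h, G p h) x := by
        have : q - p = (0, v s - u x s - s • G p h) + s • (h, G p h) := by
          simp only [hp, hq, Prod.mk_sub_mk, Prod.smul_mk, Prod.mk_add_mk, zero_add]
          congr 1
          · module
          · abel
        rw [this, map_add, map_smul]
        simp
      have hid : G q (x + h) - G p x - (s • fderiv ℝ G p (x, G p x) h + (1 : ℝ) • G p h)
          = fderiv ℝ G p (0, v s - u x s - s • G p h) x + (fderiv ℝ G p (q - p) h
            + (G q - G p - fderiv ℝ G p (q - p)) (x + h)) := by
        rw [hint s hs' x h]
        simp only [sub_apply, map_add, hsplit]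
        module
      rw [hid]
      have n1 : ‖fderiv ℝ G p (0, v s - u x s - s • G p h) x‖
          ≤ K * ‖v s - u x s - s • G p h‖ * r := by
        refine (ContinuousLinearMap.le_of_opNorm_le _ ?_ _).trans (b := _ * ‖x‖) (by gcongr)
        refine (ContinuousLinearMap.le_of_opNorm_le _ hDp _).trans_eq ?_
        simp [Prod.norm_mk]
      have n2 : ‖fderiv ℝ G p (q - p) h‖ ≤ K * (B * ‖h‖) * ‖h‖ := by
        refine ContinuousLinearMap.le_of_opNorm_le _ ?_ _
        exact (ContinuousLinearMap.le_of_opNorm_le _ hDp _).trans (by gcongr)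
      have n3 : ‖(G q - G p - fderiv ℝ G p (q - p)) (x + h)‖ ≤ C * (B * ‖h‖) ^ 2 * r := by
        refine (ContinuousLinearMap.le_of_opNorm_le _ hT _).trans ?_
        gcongr
      calc _ ≤ K * ‖v s - u x s - s • G p h‖ * r + (K * (B * ‖h‖) * ‖h‖
            + C * (B * ‖h‖) ^ 2 * r) :=
            (norm_add_le _ _).trans (add_le_add n1 ((norm_add_le _ _).trans (add_le_add n2 n3)))
        _ = _ := by rw [hD]; ring
  rw [hasFDerivAt_iff_isLittleO_nhds_zero]
  have hO : (fun h ↦ u (x + h) 1 - u x 1 - G (x, u x 1) h) =O[𝓝 0] fun h : E ↦ ‖h‖ ^ 2 := by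
    refine Asymptotics.IsBigO.of_bound (gronwallBound 0 (K * r) D 1) ?_
    have : ∀ᶠ h : E in 𝓝 0, x + h ∈ ball (0 : E) ε := by
      have hc : Filter.Tendsto (fun h : E ↦ x + h) (𝓝 0) (𝓝 x) := by
        have : Continuous fun h : E ↦ x + h := by fun_prop
        simpa using this.tendsto 0
      exact hc (isOpen_ball.mem_nhds hx)
    filter_upwards [this] with h hh
    simpa using main h hh
  exact hO.trans_isLittleO (Asymptotics.isLittleO_norm_pow_id one_lt_two)

/-- A solution of a smooth total differential system is smooth. -/
theorem contDiffOn_of_hasFDerivAt {s : Set E} (hs : IsOpen s) {Ω : Set (E × W)}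
    (hG : ContDiffOn ℝ ∞ G Ω) {f : E → W} (hf : ∀ x ∈ s, (x, f x) ∈ Ω)
    (hd : ∀ x ∈ s, HasFDerivAt f (G (x, f x)) x) : ContDiffOn ℝ ∞ f s := by
  rw [contDiffOn_infty]
  intro n
  induction n with
  | zero =>
    exact contDiffOn_zero.2 fun x hx ↦ (hd x hx).continuousAt.continuousWithinAt
  | succ n ih =>
    rw [Nat.cast_succ, contDiffOn_succ_iff_fderiv_of_isOpen hs]
    refine ⟨fun x hx ↦ (hd x hx).differentiableAt.differentiableWithinAt, by simp, ?_⟩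
    refine ContDiffOn.congr (f := fun x ↦ G (x, f x)) ?_ fun x hx ↦ (hd x hx).fderiv
    exact (hG.of_le (by exact_mod_cast le_top)).comp (contDiffOn_id.prodMk ih) hf

end TotalDifferential

/-! ### Christoffel symbols with parallel curvature -/

section Christoffel

open Metric Set

variable {E : Type*} [NormedAddCommGroup E] [NormedSpace ℝ E]

/-- The curvature `R(u, v) w` of the connection `D + Γ` on an open subset of `E`, where `Γ z u v`
are Christoffel symbols; `u` is the direction of differentiation. -/
def christoffelCurvature (Γ : E → E →L[ℝ] E →L[ℝ] E) (z : E) :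
    E →L[ℝ] E →L[ℝ] E →L[ℝ] E :=
  let B := ((ContinuousLinearMap.compL ℝ E (E →L[ℝ] E) (E →L[ℝ] E)).flip (Γ z)) ∘L
    (ContinuousLinearMap.compL ℝ E E E ∘L Γ z)
  fderiv ℝ Γ z - (fderiv ℝ Γ z).flip + (B - B.flip)

theorem christoffelCurvature_apply (Γ : E → E →L[ℝ] E →L[ℝ] E) (z u v w : E) :
    christoffelCurvature Γ z u v w = fderiv ℝ Γ z u v w - fderiv ℝ Γ z v u w +
      (Γ z u (Γ z v w) - Γ z v (Γ z u w)) := rfl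

/-- Christoffel symbols on an open set of a smooth torsion-free connection with parallel
curvature. -/
structure IsSymmetricChristoffel (Γ : E → E →L[ℝ] E →L[ℝ] E) (V : Set E) : Prop where
  isOpen : IsOpen V
  contDiffOn : ContDiffOn ℝ ∞ Γ V
  symm : ∀ z ∈ V, ∀ u v, Γ z u v = Γ z v u
  parallel : ∀ z ∈ V, ∀ a u v w,
    fderiv ℝ (christoffelCurvature Γ) z a u v w + Γ z a (christoffelCurvature Γ z u v w)
      - christoffelCurvature Γ z (Γ z a u) v w - christoffelCurvature Γ z u (Γ z a v) w
      - christoffelCurvature Γ z u v (Γ z a w) = 0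

theorem contDiffOn_christoffelCurvature [FiniteDimensional ℝ E] {Γ : E → E →L[ℝ] E →L[ℝ] E}
    {V : Set E} (hV : IsOpen V) (hΓ : ContDiffOn ℝ ∞ Γ V) :
    ContDiffOn ℝ ∞ (christoffelCurvature Γ) V := by
  have hd : ContDiffOn ℝ ∞ (fderiv ℝ Γ) V := hΓ.fderiv_of_isOpen hV (by simp)
  refine contDiffOn_clm_apply.2 fun u ↦ contDiffOn_clm_apply.2 fun v ↦
    contDiffOn_clm_apply.2 fun w ↦ ?_
  simp only [christoffelCurvature_apply]
  have c : ∀ a : E, ContDiffOn ℝ ∞ (fun _ : E ↦ a) V := fun a ↦ contDiffOn_const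
  exact ((((hd.clm_apply (c u)).clm_apply (c v)).clm_apply (c w)).sub
    (((hd.clm_apply (c v)).clm_apply (c u)).clm_apply (c w))).add
    (((hΓ.clm_apply (c u)).clm_apply ((hΓ.clm_apply (c v)).clm_apply (c w))).sub
      ((hΓ.clm_apply (c v)).clm_apply ((hΓ.clm_apply (c u)).clm_apply (c w))))

/-- The failure of a linear map `A` to intertwine two trilinear operations `R₁` and `R₂`. -/
def intertwiningDefect (R₁ R₂ : E →L[ℝ] E →L[ℝ] E →L[ℝ] E) (A : E →L[ℝ] E) :
    E →L[ℝ] E →L[ℝ] E →L[ℝ] E :=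
  (ContinuousLinearMap.compL ℝ E (E →L[ℝ] E) (E →L[ℝ] E) (ContinuousLinearMap.compL ℝ E E E A)) ∘L
      R₁ -
    (ContinuousLinearMap.compL ℝ E (E →L[ℝ] E) (E →L[ℝ] E)
      ((ContinuousLinearMap.compL ℝ E E E).flip A)) ∘L
        (((ContinuousLinearMap.compL ℝ E E (E →L[ℝ] E)).flip A) ∘L (R₂ ∘L A))

theorem intertwiningDefect_apply (R₁ R₂ : E →L[ℝ] E →L[ℝ] E →L[ℝ] E) (A : E →L[ℝ] E)
    (u v w : E) :
    intertwiningDefect R₁ R₂ A u v w = A (R₁ u v w) - R₂ (A u) (A v) (A w) := rfl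

theorem intertwiningDefect_eq_zero_iff {R₁ R₂ : E →L[ℝ] E →L[ℝ] E →L[ℝ] E} {A : E →L[ℝ] E} :
    intertwiningDefect R₁ R₂ A = 0 ↔ ∀ u v w, A (R₁ u v w) = R₂ (A u) (A v) (A w) := by
  constructor
  · intro h u v w
    have := intertwiningDefect_apply R₁ R₂ A u v w
    rw [h] at this
    exact (sub_eq_zero.1 this.symm)
  · intro h
    ext u v w
    rw [intertwiningDefect_apply, h, sub_self]
    simp

variable {Γ₁ Γ₂ : E → E →L[ℝ] E →L[ℝ] E} {V₁ V₂ : Set E}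

/-- Transport of `A` along a pair of curves with velocities `ξ`, `η` by the connections `Γ₁`,
`Γ₂` preserves the property of intertwining the curvatures, as these are parallel: the defect
satisfies a homogeneous linear differential equation. -/
theorem intertwiningDefect_eq_zero_of_transport [FiniteDimensional ℝ E]
    (h₁ : IsSymmetricChristoffel Γ₁ V₁)
    (h₂ : IsSymmetricChristoffel Γ₂ V₂) {x y ξ η : ℝ → E} {A : ℝ → E →L[ℝ] E}
    (hξ : ContinuousOn ξ (Icc 0 1)) (hη : ContinuousOn η (Icc 0 1))
    (hxV : ∀ t ∈ Icc (0 : ℝ) 1, x t ∈ V₁) (hyV : ∀ t ∈ Icc (0 : ℝ) 1, y t ∈ V₂)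
    (hx : ∀ t ∈ Icc (0 : ℝ) 1, HasDerivWithinAt x (ξ t) (Icc 0 1) t)
    (hy : ∀ t ∈ Icc (0 : ℝ) 1, HasDerivWithinAt y (η t) (Icc 0 1) t)
    (hA : ∀ t ∈ Icc (0 : ℝ) 1, HasDerivWithinAt A
      (A t ∘L Γ₁ (x t) (ξ t) - Γ₂ (y t) (η t) ∘L A t) (Icc 0 1) t)
    (h0 : intertwiningDefect (christoffelCurvature Γ₁ (x 0)) (christoffelCurvature Γ₂ (y 0))
      (A 0) = 0) :
    ∀ t ∈ Icc (0 : ℝ) 1, intertwiningDefect (christoffelCurvature Γ₁ (x t))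
      (christoffelCurvature Γ₂ (y t)) (A t) = 0 := by
  set R₁ := christoffelCurvature Γ₁ with hR₁
  set R₂ := christoffelCurvature Γ₂ with hR₂
  set S : ℝ → E →L[ℝ] E →L[ℝ] E →L[ℝ] E := fun t ↦ intertwiningDefect (R₁ (x t)) (R₂ (y t)) (A t)
    with hS
  have dR₁ : ∀ t ∈ Icc (0 : ℝ) 1, HasDerivWithinAt (fun t ↦ R₁ (x t))
      (fderiv ℝ R₁ (x t) (ξ t)) (Icc 0 1) t := fun t ht ↦
    (((contDiffOn_christoffelCurvature h₁.isOpen h₁.contDiffOn).contDiffAt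
      (h₁.isOpen.mem_nhds (hxV t ht))).differentiableAt (by simp)).hasFDerivAt.comp_hasDerivWithinAt
      t (hx t ht)
  have dR₂ : ∀ t ∈ Icc (0 : ℝ) 1, HasDerivWithinAt (fun t ↦ R₂ (y t))
      (fderiv ℝ R₂ (y t) (η t)) (Icc 0 1) t := fun t ht ↦
    (((contDiffOn_christoffelCurvature h₂.isOpen h₂.contDiffOn).contDiffAt
      (h₂.isOpen.mem_nhds (hyV t ht))).differentiableAt (by simp)).hasFDerivAt.comp_hasDerivWithinAt
      t (hy t ht)
  have dS : ∀ t ∈ Icc (0 : ℝ) 1, DifferentiableWithinAt ℝ S (Icc 0 1) t := fun t ht ↦ by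
    have d1 := (dR₁ t ht).differentiableWithinAt
    have d2 := (dR₂ t ht).differentiableWithinAt
    have d3 := (hA t ht).differentiableWithinAt
    have d4 : DifferentiableWithinAt ℝ (fun t ↦ ContinuousLinearMap.compL ℝ E E E (A t))
        (Icc 0 1) t := (ContinuousLinearMap.differentiableAt _).comp_differentiableWithinAt t d3
    have d5 : DifferentiableWithinAt ℝ (fun t ↦ ContinuousLinearMap.compL ℝ E (E →L[ℝ] E)
        (E →L[ℝ] E) (ContinuousLinearMap.compL ℝ E E E (A t))) (Icc 0 1) t :=
      (ContinuousLinearMap.differentiableAt _).comp_differentiableWithinAt t d4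
    have d6 : DifferentiableWithinAt ℝ (fun t ↦ (ContinuousLinearMap.compL ℝ E E E).flip (A t))
        (Icc 0 1) t := (ContinuousLinearMap.differentiableAt _).comp_differentiableWithinAt t d3
    have d7 : DifferentiableWithinAt ℝ (fun t ↦ ContinuousLinearMap.compL ℝ E (E →L[ℝ] E)
        (E →L[ℝ] E) ((ContinuousLinearMap.compL ℝ E E E).flip (A t))) (Icc 0 1) t :=
      (ContinuousLinearMap.differentiableAt _).comp_differentiableWithinAt t d6
    have d8 : DifferentiableWithinAt ℝ
        (fun t ↦ (ContinuousLinearMap.compL ℝ E E (E →L[ℝ] E)).flip (A t)) (Icc 0 1) t :=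
      (ContinuousLinearMap.differentiableAt _).comp_differentiableWithinAt t d3
    exact (d5.clm_comp d1).sub (d7.clm_comp (d8.clm_comp (d2.clm_comp d3)))
  have hS' : ∀ t ∈ Icc (0 : ℝ) 1, ∀ u v w, derivWithin S (Icc 0 1) t u v w =
      - Γ₂ (y t) (η t) (S t u v w) + S t (Γ₁ (x t) (ξ t) u) v w + S t u (Γ₁ (x t) (ξ t) v) w
        + S t u v (Γ₁ (x t) (ξ t) w) := by
    intro t ht u v w
    have hu : UniqueDiffWithinAt ℝ (Icc (0 : ℝ) 1) t := uniqueDiffOn_Icc zero_lt_one t ht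
    have c : ∀ a : E, HasDerivWithinAt (fun _ : ℝ ↦ a) 0 (Icc 0 1) t :=
      fun a ↦ hasDerivWithinAt_const _ _ _
    have e1 := ((((dS t ht).hasDerivWithinAt.clm_apply (c u)).clm_apply (c v)).clm_apply (c w))
    have a (u : E) := (hA t ht).clm_apply (c u)
    have e2 := ((hA t ht).clm_apply ((((dR₁ t ht).clm_apply (c u)).clm_apply (c v)).clm_apply
      (c w))).sub ((((dR₂ t ht).clm_apply (a u)).clm_apply (a v)).clm_apply (a w))
    have e3 := hu.eq_deriv _ e1 e2
    have p1 := h₁.parallel (x t) (hxV t ht) (ξ t) u v w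
    have p2 := h₂.parallel (y t) (hyV t ht) (η t) (A t u) (A t v) (A t w)
    rw [← hR₁] at p1
    rw [← hR₂] at p2
    have p1' := congrArg (A t) p1
    simp only [map_zero, add_zero, map_sub, map_add, sub_apply, add_apply,
      ContinuousLinearMap.comp_apply] at e3 p1' p2
    rw [e3]
    simp only [hS, intertwiningDefect_apply, map_sub]
    linear_combination (norm := module) p1' - p2
  have hcΓ₁ : ContinuousOn (fun t ↦ Γ₁ (x t) (ξ t)) (Icc 0 1) :=
    (h₁.contDiffOn.continuousOn.comp (fun t ht ↦ (hx t ht).continuousWithinAt) hxV).clm_apply hξ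
  have hcΓ₂ : ContinuousOn (fun t ↦ Γ₂ (y t) (η t)) (Icc 0 1) :=
    (h₂.contDiffOn.continuousOn.comp (fun t ht ↦ (hy t ht).continuousWithinAt) hyV).clm_apply hη
  obtain ⟨K₁, hK₁⟩ := isCompact_Icc.exists_bound_of_continuousOn hcΓ₁
  obtain ⟨K₂, hK₂⟩ := isCompact_Icc.exists_bound_of_continuousOn hcΓ₂
  refine eq_zero_of_abs_deriv_le_mul_abs_self_of_eq_zero_right (f := S)
    (f' := derivWithin S (Icc 0 1)) (K := K₂ + 3 * K₁)
    (fun t ht ↦ (dS t ht).continuousWithinAt)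
    (fun t ht ↦ (dS t (Ico_subset_Icc_self ht)).hasDerivWithinAt.mono_of_mem_nhdsWithin
        (Icc_mem_nhdsGE_of_mem ht)) h0 (fun t ht ↦ ?_)
  have ht' := Ico_subset_Icc_self ht
  have k1 := hK₁ t ht'
  have k2 := hK₂ t ht'
  have k10 : 0 ≤ K₁ := (norm_nonneg _).trans k1
  have k20 : 0 ≤ K₂ := (norm_nonneg _).trans k2
  have hSb : ∀ u v w, ‖S t u v w‖ ≤ ‖S t‖ * ‖u‖ * ‖v‖ * ‖w‖ := fun u v w ↦
    ((S t u v).le_opNorm w).trans (by gcongr; exact (S t).le_opNorm₂ u v)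
  have hK : 0 ≤ (K₂ + 3 * K₁) * ‖S t‖ := by positivity
  refine ContinuousLinearMap.opNorm_le_bound _ hK fun u ↦
    ContinuousLinearMap.opNorm_le_bound _ (by positivity) fun v ↦
    ContinuousLinearMap.opNorm_le_bound _ (by positivity) fun w ↦ ?_
  rw [hS' t ht']
  have b0 : ‖-Γ₂ (y t) (η t) (S t u v w)‖ ≤ K₂ * (‖S t‖ * ‖u‖ * ‖v‖ * ‖w‖) := by
    rw [norm_neg]
    exact (ContinuousLinearMap.le_of_opNorm_le _ k2 _).trans (by gcongr; exact hSb u v w)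
  have hΓb : ∀ u, ‖Γ₁ (x t) (ξ t) u‖ ≤ K₁ * ‖u‖ := fun u ↦
    ContinuousLinearMap.le_of_opNorm_le _ k1 u
  have b1 : ‖S t (Γ₁ (x t) (ξ t) u) v w‖ ≤ ‖S t‖ * (K₁ * ‖u‖) * ‖v‖ * ‖w‖ :=
    (hSb _ _ _).trans (by gcongr; exact hΓb u)
  have b2 : ‖S t u (Γ₁ (x t) (ξ t) v) w‖ ≤ ‖S t‖ * ‖u‖ * (K₁ * ‖v‖) * ‖w‖ :=
    (hSb _ _ _).trans (by gcongr; exact hΓb v)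
  have b3 : ‖S t u v (Γ₁ (x t) (ξ t) w)‖ ≤ ‖S t‖ * ‖u‖ * ‖v‖ * (K₁ * ‖w‖) :=
    (hSb _ _ _).trans (by gcongr; exact hΓb w)
  calc _ ≤ K₂ * (‖S t‖ * ‖u‖ * ‖v‖ * ‖w‖) + ‖S t‖ * (K₁ * ‖u‖) * ‖v‖ * ‖w‖
        + ‖S t‖ * ‖u‖ * (K₁ * ‖v‖) * ‖w‖ + ‖S t‖ * ‖u‖ * ‖v‖ * (K₁ * ‖w‖) :=
        norm_add_le_of_le (norm_add_le_of_le (norm_add_le_of_le b0 b1) b2) b3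
    _ = _ := by ring

/-- In a chart, the curvatures at nearby points are related by linear isomorphisms, namely by
parallel transport along straight segments. -/
theorem eventually_exists_intertwining [FiniteDimensional ℝ E]
    {Γ : E → E →L[ℝ] E →L[ℝ] E} {V : Set E}
    (h : IsSymmetricChristoffel Γ V) {p : E} (hp : p ∈ V) :
    ∀ᶠ y in 𝓝 p, ∃ A : E ≃L[ℝ] E, ∀ u v w, A (christoffelCurvature Γ p u v w) =
      christoffelCurvature Γ y (A u) (A v) (A w) := by
  -- parallel transport as a total differential system in the unknown `A`
  set G : E × (E →L[ℝ] E) → E →L[ℝ] (E →L[ℝ] E) := fun P ↦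
    -(((ContinuousLinearMap.compL ℝ E E E).flip P.2) ∘L Γ (p + P.1)) with hGdef
  have hΓ : ContDiffAt ℝ ∞ Γ (p + 0) := by
    rw [add_zero]; exact h.contDiffOn.contDiffAt (h.isOpen.mem_nhds hp)
  have hG : ContDiffAt ℝ 2 G (0, ContinuousLinearMap.id ℝ E) := by
    have c1 : ContDiffAt ℝ ∞ (fun P : E × (E →L[ℝ] E) ↦ Γ (p + P.1))
        (0, ContinuousLinearMap.id ℝ E) :=
      ContDiffAt.comp (g := Γ) (f := fun P : E × (E →L[ℝ] E) ↦ p + P.1) _ hΓ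
        (contDiffAt_const.add contDiffAt_fst)
    have c2 : ContDiffAt ℝ ∞ (fun P : E × (E →L[ℝ] E) ↦
        (ContinuousLinearMap.compL ℝ E E E).flip P.2) (0, ContinuousLinearMap.id ℝ E) :=
      (ContinuousLinearMap.contDiff _).contDiffAt.comp _ contDiffAt_snd
    exact ((c2.clm_comp c1).neg).of_le ENat.LEInfty.out
  set N : Set (E × (E →L[ℝ] E)) := {P | p + P.1 ∈ V ∧ IsUnit P.2} with hN
  have hN0 : N ∈ 𝓝 ((0 : E), ContinuousLinearMap.id ℝ E) := by
    have : IsOpen N := (h.isOpen.preimage (continuous_const.add continuous_fst)).inter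
      (Units.isOpen.preimage continuous_snd)
    exact this.mem_nhds ⟨by simpa using hp, isUnit_one⟩
  obtain ⟨r, L, K, C, hT, hr⟩ := exists_taylorBounds hG hN0
  obtain ⟨ε, hε, hex⟩ := exists_isRadialSolution hT
  filter_upwards [ball_mem_nhds p hε] with y hy
  obtain ⟨A, hA⟩ := hex (y - p) (by simpa [dist_eq_norm] using hy)
  have hunit : IsUnit (A 1) := (hr (hA.mem 1 (by simp))).2
  have key := intertwiningDefect_eq_zero_of_transport h h (x := fun _ ↦ p)
    (y := fun t ↦ p + t • (y - p)) (ξ := fun _ ↦ 0) (η := fun _ ↦ y - p) (A := A)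
    continuousOn_const continuousOn_const (fun _ _ ↦ hp)
    (fun t ht ↦ (hr (hA.mem t ht)).1) (fun t _ ↦ hasDerivWithinAt_const _ _ _)
    (fun t _ ↦ by
      simpa using (((hasDerivAt_id t).smul_const (y - p)).const_add p).hasDerivWithinAt)
    (fun t ht ↦ by
      refine (hA.hasDerivWithinAt t ht).congr_deriv ?_
      ext w
      simp [hGdef])
    (by
      rw [intertwiningDefect_eq_zero_iff, hA.init]
      simp) 1 (by simp)
  obtain ⟨a, ha⟩ := hunit
  refine ⟨ContinuousLinearEquiv.unitsEquiv ℝ E a, ?_⟩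
  rw [intertwiningDefect_eq_zero_iff, ← ha] at key
  simpa using key

/-- The total differential system for a local affine map: the unknowns are the map `y` and its
derivative `A`, and the system says `D y = A`, `D A h = A ∘ Γ₁ h - Γ₂ (A h) ∘ A`. The origin is
translated to `p`, so that initial values are prescribed at `0`. -/
def affineSystem (Γ₁ Γ₂ : E → E →L[ℝ] E →L[ℝ] E) (p : E)
    (P : E × (E × (E →L[ℝ] E))) : E →L[ℝ] E × (E →L[ℝ] E) :=
  ContinuousLinearMap.inl ℝ E (E →L[ℝ] E) ∘L P.2.2 + ContinuousLinearMap.inr ℝ E (E →L[ℝ] E) ∘L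
    ((ContinuousLinearMap.compL ℝ E E E P.2.2) ∘L Γ₁ (p + P.1)
      - ((ContinuousLinearMap.compL ℝ E E E).flip P.2.2) ∘L (Γ₂ P.2.1 ∘L P.2.2))

theorem affineSystem_apply (Γ₁ Γ₂ : E → E →L[ℝ] E →L[ℝ] E) (p : E)
    (P : E × (E × (E →L[ℝ] E))) (h : E) : affineSystem Γ₁ Γ₂ p P h =
      (P.2.2 h, P.2.2 ∘L Γ₁ (p + P.1) h - Γ₂ P.2.1 (P.2.2 h) ∘L P.2.2) := by
  simp [affineSystem]

theorem contDiffOn_affineSystem (h₁ : IsSymmetricChristoffel Γ₁ V₁)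
    (h₂ : IsSymmetricChristoffel Γ₂ V₂) (p : E) :
    ContDiffOn ℝ ∞ (affineSystem Γ₁ Γ₂ p) {P | p + P.1 ∈ V₁ ∧ P.2.1 ∈ V₂} := by
  set Ω : Set (E × (E × (E →L[ℝ] E))) := {P | p + P.1 ∈ V₁ ∧ P.2.1 ∈ V₂}
  have c1 : ContDiffOn ℝ ∞ (fun P : E × (E × (E →L[ℝ] E)) ↦ Γ₁ (p + P.1)) Ω :=
    h₁.contDiffOn.comp (contDiff_const.add contDiff_fst).contDiffOn fun P hP ↦ hP.1
  have c2 : ContDiffOn ℝ ∞ (fun P : E × (E × (E →L[ℝ] E)) ↦ Γ₂ P.2.1) Ω :=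
    h₂.contDiffOn.comp (contDiff_fst.comp contDiff_snd).contDiffOn fun P hP ↦ hP.2
  have c3 : ContDiffOn ℝ ∞ (fun P : E × (E × (E →L[ℝ] E)) ↦ P.2.2) Ω :=
    (contDiff_snd.comp contDiff_snd).contDiffOn
  have c4 : ContDiffOn ℝ ∞ (fun P : E × (E × (E →L[ℝ] E)) ↦
      ContinuousLinearMap.compL ℝ E E E P.2.2) Ω :=
    (ContinuousLinearMap.contDiff _).comp_contDiffOn c3
  have c5 : ContDiffOn ℝ ∞ (fun P : E × (E × (E →L[ℝ] E)) ↦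
      (ContinuousLinearMap.compL ℝ E E E).flip P.2.2) Ω :=
    (ContinuousLinearMap.contDiff _).comp_contDiffOn c3
  exact (contDiffOn_const.clm_comp c3).add (contDiffOn_const.clm_comp
    ((c4.clm_comp c1).sub (c5.clm_comp (c2.clm_comp c3))))

/-- The system for affine maps is integrable wherever the linear part intertwines the curvatures;
the first component uses that the connections are torsion-free. -/
theorem isIntegrableAt_affineSystem (h₁ : IsSymmetricChristoffel Γ₁ V₁)
    (h₂ : IsSymmetricChristoffel Γ₂ V₂) {p x y : E} {A : E →L[ℝ] E} (hx : p + x ∈ V₁)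
    (hy : y ∈ V₂) (hA : ∀ u v w, A (christoffelCurvature Γ₁ (p + x) u v w) =
      christoffelCurvature Γ₂ y (A u) (A v) (A w)) :
    IsIntegrableAt (affineSystem Γ₁ Γ₂ p) (x, y, A) := by
  set P : E × (E × (E →L[ℝ] E)) := (x, y, A) with hP
  have hopen : IsOpen {P : E × (E × (E →L[ℝ] E)) | p + P.1 ∈ V₁ ∧ P.2.1 ∈ V₂} :=
    (h₁.isOpen.preimage (continuous_const.add continuous_fst)).inter
      (h₂.isOpen.preimage (continuous_fst.comp continuous_snd))
  have hd : DifferentiableAt ℝ (affineSystem Γ₁ Γ₂ p) P :=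
    ((contDiffOn_affineSystem h₁ h₂ p).contDiffAt (hopen.mem_nhds ⟨hx, hy⟩)).differentiableAt
      (by simp)
  have dΓ₁ : HasFDerivAt Γ₁ (fderiv ℝ Γ₁ (p + x)) (p + x) :=
    ((h₁.contDiffOn.contDiffAt (h₁.isOpen.mem_nhds hx)).differentiableAt (by simp)).hasFDerivAt
  have dΓ₂ : HasFDerivAt Γ₂ (fderiv ℝ Γ₂ y) y :=
    ((h₂.contDiffOn.contDiffAt (h₂.isOpen.mem_nhds hy)).differentiableAt (by simp)).hasFDerivAt
  -- the derivative of the system in the direction `(a, b, B)`, by restriction to a line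
  have formula : ∀ (a b : E) (B : E →L[ℝ] E) (k : E),
      (fderiv ℝ (affineSystem Γ₁ Γ₂ p) P (a, b, B) k).1 = B k ∧
      ∀ w, (fderiv ℝ (affineSystem Γ₁ Γ₂ p) P (a, b, B) k).2 w =
        B (Γ₁ (p + x) k w) + A (fderiv ℝ Γ₁ (p + x) a k w)
          - (fderiv ℝ Γ₂ y b (A k) (A w) + Γ₂ y (B k) (A w) + Γ₂ y (A k) (B w)) := by
    intro a b B k
    have lx : HasDerivAt (fun s : ℝ ↦ x + s • a) a 0 := by
      simpa using ((hasDerivAt_id (0 : ℝ)).smul_const a).const_add x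
    have ly : HasDerivAt (fun s : ℝ ↦ y + s • b) b 0 := by
      simpa using ((hasDerivAt_id (0 : ℝ)).smul_const b).const_add y
    have lA : HasDerivAt (fun s : ℝ ↦ A + s • B) B 0 := by
      simpa using ((hasDerivAt_id (0 : ℝ)).smul_const B).const_add A
    have lP := lx.prodMk (ly.prodMk lA)
    have lG : HasDerivAt (fun s : ℝ ↦ affineSystem Γ₁ Γ₂ p (x + s • a, y + s • b, A + s • B) k)
        (fderiv ℝ (affineSystem Γ₁ Γ₂ p) P (a, b, B) k) 0 := by
      have e := hd.hasFDerivAt.comp_hasDerivAt_of_eq (0 : ℝ) lP (by simp [hP])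
      exact (ContinuousLinearMap.apply ℝ (E × (E →L[ℝ] E)) k).hasFDerivAt.comp_hasDerivAt 0 e
    simp only [affineSystem_apply] at lG
    have c (w : E) := hasDerivAt_const (0 : ℝ) w
    have l₁ : HasDerivAt (fun s : ℝ ↦ Γ₁ (p + (x + s • a))) (fderiv ℝ Γ₁ (p + x) a) 0 :=
      dΓ₁.comp_hasDerivAt_of_eq (0 : ℝ) (lx.const_add p) (by simp)
    have l₂ : HasDerivAt (fun s : ℝ ↦ Γ₂ (y + s • b)) (fderiv ℝ Γ₂ y b) 0 :=
      dΓ₂.comp_hasDerivAt_of_eq (0 : ℝ) ly (by simp)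
    have lAu (u : E) : HasDerivAt (fun s : ℝ ↦ (A + s • B) u) (B u) 0 := by
      simpa using lA.clm_apply (c u)
    constructor
    · exact ((ContinuousLinearMap.fst ℝ E (E →L[ℝ] E)).hasFDerivAt.comp_hasDerivAt 0 lG).unique (lAu k)
    · intro w
      have e0 := (ContinuousLinearMap.snd ℝ E (E →L[ℝ] E)).hasFDerivAt.comp_hasDerivAt 0 lG
      have e1 := e0.clm_apply (c w)
      have e2 := (lA.clm_apply ((l₁.clm_apply (c k)).clm_apply (c w))).sub
        ((l₂.clm_apply (lAu k)).clm_apply (lAu w))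
      have e3 := e1.unique e2
      simp only [zero_smul, add_zero, map_zero, add_apply] at e3
      exact e3
  intro h k
  obtain ⟨f1, f2⟩ := formula h (A h) (A ∘L Γ₁ (p + x) h - Γ₂ y (A h) ∘L A) k
  obtain ⟨g1, g2⟩ := formula k (A k) (A ∘L Γ₁ (p + x) k - Γ₂ y (A k) ∘L A) h
  rw [affineSystem_apply, affineSystem_apply]
  have hsymm : (A ∘L Γ₁ (p + x) h - Γ₂ y (A h) ∘L A) k
      = (A ∘L Γ₁ (p + x) k - Γ₂ y (A k) ∘L A) h := by
    simp only [sub_apply, ContinuousLinearMap.comp_apply]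
    rw [h₁.symm _ hx h k, h₂.symm _ hy (A h) (A k)]
  refine Prod.ext ?_ ?_
  · exact f1.trans (hsymm.trans g1.symm)
  · ext w
    refine (f2 w).trans (Eq.trans ?_ (g2 w).symm)
    rw [hsymm]
    have := hA h k w
    simp only [christoffelCurvature_apply, map_add, map_sub] at this
    simp only [sub_apply, ContinuousLinearMap.comp_apply, map_sub]
    linear_combination (norm := module) this

/-- The local Cartan theorem: a linear map intertwining the curvatures at `p` and `q` is the
derivative of a smooth map which satisfies the second order equation of affine maps. -/
theorem exists_affine_map [FiniteDimensional ℝ E]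
    (h₁ : IsSymmetricChristoffel Γ₁ V₁)
    (h₂ : IsSymmetricChristoffel Γ₂ V₂) {p q : E} (hp : p ∈ V₁) (hq : q ∈ V₂) {A₀ : E →L[ℝ] E}
    (hA₀ : ∀ u v w, A₀ (christoffelCurvature Γ₁ p u v w) =
      christoffelCurvature Γ₂ q (A₀ u) (A₀ v) (A₀ w)) :
    ∃ ε > 0, ∃ (φ : E → E) (A : E → E →L[ℝ] E), φ p = q ∧ A p = A₀ ∧
      ContDiffOn ℝ ∞ φ (ball p ε) ∧ ∀ x ∈ ball p ε, x ∈ V₁ ∧ φ x ∈ V₂ ∧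
        HasFDerivAt φ (A x) x ∧ ∃ A' : E →L[ℝ] E →L[ℝ] E, HasFDerivAt A A' x ∧
          ∀ h k, A' h k = A x (Γ₁ x h k) - Γ₂ (φ x) (A x h) (A x k) := by
  set Ω : Set (E × (E × (E →L[ℝ] E))) := {P | p + P.1 ∈ V₁ ∧ P.2.1 ∈ V₂}
  have hopen : IsOpen Ω :=
    (h₁.isOpen.preimage (continuous_const.add continuous_fst)).inter
      (h₂.isOpen.preimage (continuous_fst.comp continuous_snd))
  set u₀ : E × (E →L[ℝ] E) := (q, A₀) with hu₀
  have hN : Ω ∈ 𝓝 ((0 : E), u₀) := hopen.mem_nhds ⟨by simpa using hp, hq⟩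
  have hG := contDiffOn_affineSystem h₁ h₂ p
  obtain ⟨r, L, K, C, hT, hr⟩ := exists_taylorBounds
    ((hG.contDiffAt hN).of_le ENat.LEInfty.out) hN
  obtain ⟨ε', hε', hex⟩ := exists_isRadialSolution hT
  set ε := min ε' r
  have hε : 0 < ε := lt_min hε' hT.r_pos
  choose! u hu using hex
  have hu' : ∀ x ∈ ball (0 : E) ε, IsRadialSolution (affineSystem Γ₁ Γ₂ p) u₀ r x (u x) :=
    fun x hx ↦ hu x (ball_subset_ball (min_le_left _ _) hx)
  have hmem : ∀ x ∈ ball (0 : E) ε, (x, u x 1) ∈ Ω := fun x hx ↦ by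
    simpa using hr ((hu' x hx).mem 1 (by simp))
  have hd : ∀ x ∈ ball (0 : E) ε, HasFDerivAt (fun y ↦ u y 1)
      (affineSystem Γ₁ Γ₂ p (x, u x 1)) x := by
    intro x hx
    refine hasFDerivAt_of_isRadialSolution hT (min_le_right _ _) hu' hx fun t ht ↦ ?_
    have hm := hu' x hx
    have hV := fun t ht ↦ hr (hm.mem t ht)
    have hder := fun t ht ↦ affineSystem_apply Γ₁ Γ₂ p (t • x, u x t) x ▸ hm.hasDerivWithinAt t ht
    have key := intertwiningDefect_eq_zero_of_transport h₁ h₂ (x := fun t ↦ p + t • x)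
      (y := fun t ↦ (u x t).1) (ξ := fun _ ↦ x) (η := fun t ↦ (u x t).2 x)
      (A := fun t ↦ (u x t).2) continuousOn_const
      (hm.continuousOn.snd.clm_apply continuousOn_const)
      (fun t ht ↦ (hV t ht).1) (fun t ht ↦ (hV t ht).2)
      (fun t _ ↦ by simpa using (((hasDerivAt_id t).smul_const x).const_add p).hasDerivWithinAt)
      (fun t ht ↦ (hder t ht).fst) (fun t ht ↦ (hder t ht).snd)
      (by
        rw [intertwiningDefect_eq_zero_iff, hm.init]
        simpa using hA₀) t ht
    exact isIntegrableAt_affineSystem h₁ h₂ (hV t ht).1 (hV t ht).2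
      (intertwiningDefect_eq_zero_iff.1 key)
  have hsm := contDiffOn_of_hasFDerivAt isOpen_ball hG hmem hd
  have hball : ∀ x ∈ ball p ε, x - p ∈ ball (0 : E) ε := fun x hx ↦ by
    simpa [dist_eq_norm] using hx
  have h0 : u 0 1 = u₀ := by
    have hm := hu' 0 (mem_ball_self hε)
    have hc : ∀ t ∈ Icc (0 : ℝ) 1, u 0 t = u 0 0 := constant_of_has_deriv_right_zero
      hm.continuousOn fun t ht ↦ by simpa using hm.hasDerivWithinAt_Ici ht
    rw [hc 1 (by simp), hm.init]
  refine ⟨ε, hε, fun x ↦ (u (x - p) 1).1, fun x ↦ (u (x - p) 1).2, by simp [h0, hu₀],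
    by simp [h0, hu₀], ?_, fun x hx ↦ ?_⟩
  · exact contDiff_fst.comp_contDiffOn
      (hsm.comp (contDiff_id.sub contDiff_const).contDiffOn hball)
  · have hx' := hball x hx
    obtain ⟨m1, m2⟩ := hmem _ hx'
    simp only [add_sub_cancel] at m1
    have hd1 : HasFDerivAt (fun y ↦ u (y - p) 1) (affineSystem Γ₁ Γ₂ p (x - p, u (x - p) 1)) x := by
      exact (hd _ hx').comp x ((hasFDerivAt_id x).sub_const p)
    refine ⟨m1, m2, hd1.fst.congr_fderiv ?_, _, hd1.snd, fun h k ↦ ?_⟩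
    · ext h
      simp [affineSystem_apply]
    · simp [affineSystem_apply]

end Christoffel

/-! ### Vector fields and connections in a chart -/

section Chart

variable {E : Type*} [NormedAddCommGroup E] [NormedSpace ℝ E]
  {M : Type*} [TopologicalSpace M] [ChartedSpace E M] [IsManifold 𝓘(ℝ, E) ∞ M]

/-- The identification of the tangent space at `x` with `E` by the chart at `P`; it is zero unless
`x` lies in the source of this chart. -/
def toChart (P x : M) : TangentSpace 𝓘(ℝ, E) x →L[ℝ] E :=
  (trivializationAt E (TangentSpace 𝓘(ℝ, E)) P).continuousLinearMapAt ℝ x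

/-- The inverse of `toChart`. -/
def ofChart (P x : M) : E →L[ℝ] TangentSpace 𝓘(ℝ, E) x :=
  (trivializationAt E (TangentSpace 𝓘(ℝ, E)) P).symmL ℝ x

/-- A vector field read in the chart at `P`. -/
def chartRep (P : M) (X : Π x : M, TangentSpace 𝓘(ℝ, E) x) (z : E) : E :=
  toChart P ((chartAt E P).symm z) (X ((chartAt E P).symm z))

variable {P x : M} {X Y Z : Π x : M, TangentSpace 𝓘(ℝ, E) x}

theorem ofChart_toChart (hx : x ∈ (chartAt E P).source) (v : TangentSpace 𝓘(ℝ, E) x) :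
    ofChart P x (toChart P x v) = v :=
  Trivialization.symmL_continuousLinearMapAt _ hx v

theorem toChart_ofChart (hx : x ∈ (chartAt E P).source) (v : E) :
    toChart P x (ofChart P x v) = v :=
  Trivialization.continuousLinearMapAt_symmL _ hx v

/-- The identification of the tangent space at a point of the chart at `P` with `E`. -/
def chartEquiv (hx : x ∈ (chartAt E P).source) : TangentSpace 𝓘(ℝ, E) x ≃ₗ[ℝ] E where
  __ := (toChart P x).toLinearMap
  invFun := ofChart P x
  left_inv := ofChart_toChart hx
  right_inv := toChart_ofChart hx

theorem toChart_eq_mfderiv (hx : x ∈ (chartAt E P).source) :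
    toChart P x = mfderiv 𝓘(ℝ, E) 𝓘(ℝ, E) (chartAt E P) x := by
  have := TangentBundle.continuousLinearMapAt_trivializationAt (I := 𝓘(ℝ, E)) hx
  simp only [mfld_simps] at this
  exact this

theorem ofChart_eq_mfderiv (hx : x ∈ (chartAt E P).source) :
    ofChart (E := E) P x = mfderiv 𝓘(ℝ, E) 𝓘(ℝ, E) (chartAt E P).symm (chartAt E P x) := by
  have := TangentBundle.symmL_trivializationAt (I := 𝓘(ℝ, E)) hx
  simp only [mfld_simps, mfderivWithin_univ] at this
  exact this

theorem chartRep_chartAt (hx : x ∈ (chartAt E P).source) :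
    chartRep P X (chartAt E P x) = toChart P x (X x) := by
  rw [chartRep, (chartAt E P).left_inv hx]

theorem contMDiffAt_chartAt_symm {z : E} (hz : z ∈ (chartAt E P).target) :
    ContMDiffAt 𝓘(ℝ, E) 𝓘(ℝ, E) ∞ (chartAt E P).symm z :=
  (contMDiffOn_chart_symm).contMDiffAt ((chartAt E P).open_target.mem_nhds hz)

theorem contMDiffAt_chartAt_coe (hx : x ∈ (chartAt E P).source) :
    ContMDiffAt 𝓘(ℝ, E) 𝓘(ℝ, E) ∞ (chartAt E P) x :=
  contMDiffOn_chart.contMDiffAt ((chartAt E P).open_source.mem_nhds hx)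

theorem contDiffAt_comp_chartAt_symm {F : Type*} [NormedAddCommGroup F] [NormedSpace ℝ F]
    {n : ℕ∞} {f : M → F} (hx : x ∈ (chartAt E P).source)
    (hf : ContMDiffAt 𝓘(ℝ, E) 𝓘(ℝ, F) n f x) :
    ContDiffAt ℝ n (f ∘ (chartAt E P).symm) (chartAt E P x) := by
  rw [← contMDiffAt_iff_contDiffAt]
  refine ContMDiffAt.comp (I' := 𝓘(ℝ, E)) _ ?_
    ((contMDiffAt_chartAt_symm ((chartAt E P).map_source hx)).of_le (by exact_mod_cast le_top))
  rwa [(chartAt E P).left_inv hx]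

theorem mdifferentiableAt_comp_chartAt_symm {F : Type*} [NormedAddCommGroup F] [NormedSpace ℝ F]
    {f : M → F} (hx : x ∈ (chartAt E P).source) (hf : MDifferentiableAt 𝓘(ℝ, E) 𝓘(ℝ, F) f x) :
    DifferentiableAt ℝ (f ∘ (chartAt E P).symm) (chartAt E P x) := by
  rw [← mdifferentiableAt_iff_differentiableAt]
  refine MDifferentiableAt.comp (I' := 𝓘(ℝ, E)) _ ?_
    ((contMDiffAt_chartAt_symm ((chartAt E P).map_source hx)).mdifferentiableAt (by simp))
  rwa [(chartAt E P).left_inv hx]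

theorem chartRep_eqOn (P : M) (X : Π x : M, TangentSpace 𝓘(ℝ, E) x) :
    Set.EqOn (chartRep P X) ((fun x ↦
      ((trivializationAt E (TangentSpace 𝓘(ℝ, E)) P) ⟨x, X x⟩).2) ∘ (chartAt E P).symm)
      (chartAt E P).target := fun z hz ↦ by
  have : (chartAt E P).symm z ∈ (trivializationAt E (TangentSpace 𝓘(ℝ, E)) P).baseSet :=
    (chartAt E P).map_target hz
  exact Trivialization.continuousLinearMapAt_apply_of_mem _ _ this _

theorem chartRep_eventuallyEq (hx : x ∈ (chartAt E P).source) :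
    chartRep P X =ᶠ[𝓝 (chartAt E P x)] ((fun x ↦
      ((trivializationAt E (TangentSpace 𝓘(ℝ, E)) P) ⟨x, X x⟩).2) ∘ (chartAt E P).symm) :=
  Filter.eventuallyEq_of_mem ((chartAt E P).open_target.mem_nhds ((chartAt E P).map_source hx))
    (chartRep_eqOn P X)

theorem contDiffAt_chartRep (hx : x ∈ (chartAt E P).source) (hX : IsSmoothField X) :
    ContDiffAt ℝ ∞ (chartRep P X) (chartAt E P x) := by
  refine ContDiffAt.congr_of_eventuallyEq ?_ (chartRep_eventuallyEq hx)
  exact contDiffAt_comp_chartAt_symm hx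
    ((Trivialization.contMDiffAt_section_iff (IB := 𝓘(ℝ, E)) _ hx).1 (hX x))

theorem contDiffOn_chartRep (P : M) (hX : IsSmoothField X) :
    ContDiffOn ℝ ∞ (chartRep P X) (chartAt E P).target := fun z hz ↦ by
  have := contDiffAt_chartRep ((chartAt E P).map_target hz) hX
  rw [(chartAt E P).right_inv hz] at this
  exact this.contDiffWithinAt

theorem differentiableAt_chartRep (hx : x ∈ (chartAt E P).source) (hX : MDiffAt (T% X) x) :
    DifferentiableAt ℝ (chartRep P X) (chartAt E P x) := by
  refine DifferentiableAt.congr_of_eventuallyEq ?_ (chartRep_eventuallyEq hx)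
  exact mdifferentiableAt_comp_chartAt_symm hx
    ((Trivialization.mdifferentiableAt_section_iff 𝓘(ℝ, E) _ _ hx).1 hX)

theorem mvfderiv_eq_fderiv_chart {F : Type*} [NormedAddCommGroup F] [NormedSpace ℝ F]
    {f : M → F} (hx : x ∈ (chartAt E P).source) (hf : MDifferentiableAt 𝓘(ℝ, E) 𝓘(ℝ, F) f x)
    (u : TangentSpace 𝓘(ℝ, E) x) :
    mvfderiv 𝓘(ℝ, E) f x u =
      fderiv ℝ (f ∘ (chartAt E P).symm) (chartAt E P x) (toChart P x u) := by
  have h1 : f =ᶠ[𝓝 x] (f ∘ (chartAt E P).symm) ∘ chartAt E P := by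
    filter_upwards [(chartAt E P).open_source.mem_nhds hx] with y hy
    simp [(chartAt E P).left_inv hy]
  have h2 : mfderiv 𝓘(ℝ, E) 𝓘(ℝ, F) f x =
      mfderiv 𝓘(ℝ, E) 𝓘(ℝ, F) ((f ∘ (chartAt E P).symm) ∘ chartAt E P) x := h1.mfderiv_eq
  have h3 := mfderiv_comp x (I' := 𝓘(ℝ, E))
    (mdifferentiableAt_iff_differentiableAt.2 (mdifferentiableAt_comp_chartAt_symm hx hf))
    ((contMDiffAt_chartAt_coe hx).mdifferentiableAt (by simp))
  rw [toChart_eq_mfderiv hx, mvfderiv]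
  have h4 := h2.trans h3
  rw [mfderiv_eq_fderiv] at h4
  have h5 := congrArg (fun L ↦ L u) h4
  exact h5

/-- The Lie bracket on the model space, where the tangent spaces are `E` by definition. -/
theorem mlieBracket_model_space (V W : E → E) (z : E) :
    (mlieBracket 𝓘(ℝ, E) V W z : E) = fderiv ℝ W z (V z) - fderiv ℝ V z (W z) := by
  have h : lieBracketWithin ℝ V W Set.univ z = fderiv ℝ W z (V z) - fderiv ℝ V z (W z) := by
    rw [lieBracketWithin_univ, lieBracket_eq]
  exact (congrFun (mlieBracketWithin_eq_lieBracketWithin (V := V) (W := W) (s := Set.univ)) z).trans h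

theorem chartRep_mlieBracket [FiniteDimensional ℝ E] (hx : x ∈ (chartAt E P).source)
    (hX : MDiffAt (T% X) x) (hY : MDiffAt (T% Y) x) :
    toChart P x (mlieBracket 𝓘(ℝ, E) X Y x) =
      fderiv ℝ (chartRep P Y) (chartAt E P x) (toChart P x (X x)) -
        fderiv ℝ (chartRep P X) (chartAt E P x) (toChart P x (Y x)) := by
  have : CompleteSpace E := FiniteDimensional.complete ℝ E
  have : IsManifold 𝓘(ℝ, E) (minSmoothness ℝ 2) M :=
    IsManifold.of_le (n := ∞) (by simp only [minSmoothness_of_isRCLikeNormedField]; exact ENat.LEInfty.out)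
  have hz := (chartAt E P).map_source hx
  have hpull : ∀ (W : Π x : M, TangentSpace 𝓘(ℝ, E) x), ∀ z ∈ (chartAt E P).target,
      mpullback 𝓘(ℝ, E) 𝓘(ℝ, E) (chartAt E P).symm W z = chartRep P W z := by
    intro W z hz
    have hs := (chartAt E P).map_target hz
    have h1 : (mfderiv 𝓘(ℝ, E) 𝓘(ℝ, E) (chartAt E P).symm z) =
        ofChart (E := E) P ((chartAt E P).symm z) := by
      have := ofChart_eq_mfderiv hs
      rw [(chartAt E P).right_inv hz] at this
      exact this.symm
    have h2 : (ofChart (E := E) P ((chartAt E P).symm z)).inverse = toChart P ((chartAt E P).symm z) :=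
      ContinuousLinearMap.inverse_eq (by ext v; exact ofChart_toChart hs v)
        (by ext v; exact toChart_ofChart hs v)
    rw [mpullback_apply, h1]
    exact congrArg (fun L ↦ L (W ((chartAt E P).symm z))) h2
  have hev : ∀ W : Π x : M, TangentSpace 𝓘(ℝ, E) x,
      mpullback 𝓘(ℝ, E) 𝓘(ℝ, E) (chartAt E P).symm W =ᶠ[𝓝 (chartAt E P x)] chartRep P W :=
    fun W ↦ Filter.eventuallyEq_of_mem ((chartAt E P).open_target.mem_nhds hz) (hpull W)
  have hl := (chartAt E P).left_inv hx
  have key := mpullback_mlieBracket (n := ∞) (f := (chartAt E P).symm) (x₀ := chartAt E P x)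
    (V := X) (W := Y) (by rwa [hl]) (by rwa [hl]) (contMDiffAt_chartAt_symm hz) (by
      simp only [minSmoothness_of_isRCLikeNormedField]; exact ENat.LEInfty.out)
  rw [hpull _ _ hz, chartRep_chartAt hx] at key
  have e1 : fderiv ℝ (mpullback 𝓘(ℝ, E) 𝓘(ℝ, E) (chartAt E P).symm X : E → E) (chartAt E P x) =
      fderiv ℝ (chartRep P X) (chartAt E P x) := (hev X).fderiv_eq
  have e2 : fderiv ℝ (mpullback 𝓘(ℝ, E) 𝓘(ℝ, E) (chartAt E P).symm Y : E → E) (chartAt E P x) =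
      fderiv ℝ (chartRep P Y) (chartAt E P x) := (hev Y).fderiv_eq
  have e3 := (hev X).eq_of_nhds
  have e4 := (hev Y).eq_of_nhds
  rw [chartRep_chartAt hx] at e3 e4
  refine (key.trans (mlieBracket_model_space _ _ _)).trans ?_
  exact congrArg₂ (fun a b : E ↦ a - b) (congrArg₂ (fun (A : E →L[ℝ] E) a ↦ A a) e2 e3)
    (congrArg₂ (fun (A : E →L[ℝ] E) a ↦ A a) e1 e4)

end Chart

/-! ### Christoffel symbols of a connection on a manifold -/

section ChristoffelOfConnection

variable {E : Type*} [NormedAddCommGroup E] [NormedSpace ℝ E] [FiniteDimensional ℝ E]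
  {M : Type*} [TopologicalSpace M] [T2Space M] [ChartedSpace E M] [IsManifold 𝓘(ℝ, E) ∞ M]

/-- A global smooth vector field that is constant equal to `w` in the chart at `P`, near `P`. -/
def constField (P : M) (w : E) : Π x : M, TangentSpace 𝓘(ℝ, E) x :=
  extendField (ofChart P P w)

/-- A neighborhood, in the chart at `P`, of the image of `P`, on which all the fields
`constField P w` are constant. -/
def chartCore (P : M) : Set E :=
  interior {z | z ∈ (chartAt E P).target ∧ ∀ w, chartRep P (constField P w) z = w}

theorem isOpen_chartCore (P : M) : IsOpen (chartCore (E := E) P) := isOpen_interior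

theorem chartCore_subset_target (P : M) : chartCore (E := E) P ⊆ (chartAt E P).target :=
  fun _ hz ↦ (interior_subset hz).1

theorem chartRep_constField {P : M} {z : E} (hz : z ∈ chartCore P) (w : E) :
    chartRep P (constField P w) z = w := (interior_subset hz).2 w

theorem mem_chartCore (P : M) : chartAt E P P ∈ chartCore (E := E) P := by
  set χ := Classical.arbitrary (SmoothBumpFunction 𝓘(ℝ, E) P) with hχ
  have h1 : ∀ᶠ z in 𝓝 (chartAt E P P), χ ((chartAt E P).symm z) = 1 := by
    have hc := (chartAt E P).symm.continuousAt ((chartAt E P).map_source (mem_chart_source E P))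
    have h2 : Filter.Tendsto (chartAt E P).symm (𝓝 (chartAt E P P)) (𝓝 P) := by
      have := hc.tendsto
      rwa [(chartAt E P).left_inv (mem_chart_source E P)] at this
    exact h2.eventually χ.eventuallyEq_one
  rw [chartCore, mem_interior_iff_mem_nhds]
  filter_upwards [h1, (chartAt E P).open_target.mem_nhds
    ((chartAt E P).map_source (mem_chart_source E P))] with z hz hzt
  refine ⟨hzt, fun w ↦ ?_⟩
  have hs := (chartAt E P).map_target hzt
  have h3 : constField P w ((chartAt E P).symm z) = ofChart P ((chartAt E P).symm z) w := by
    have : (trivializationAt E (TangentSpace 𝓘(ℝ, E)) P).linearMapAt ℝ P (ofChart P P w) = w :=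
      toChart_ofChart (mem_chart_source E P) w
    rw [constField, extendField, ← hχ, hz, one_smul, this]
    rfl
  rw [chartRep, h3, toChart_ofChart hs]

theorem constField_smooth (P : M) (w : E) : IsSmoothField (constField P w) :=
  extendField_smooth _

theorem constField_apply {P x : M} (hx : x ∈ (chartAt E P).source)
    (hxc : chartAt E P x ∈ chartCore P) (w : E) : constField P w x = ofChart P x w := by
  have h := chartRep_constField hxc w
  rw [chartRep_chartAt hx] at h
  rw [← ofChart_toChart hx (constField P w x), h]

theorem fderiv_chartRep_constField {P : M} {z : E} (hz : z ∈ chartCore P) (w : E) :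
    fderiv ℝ (chartRep P (constField P w)) z = 0 := by
  have : chartRep P (constField P w) =ᶠ[𝓝 z] fun _ ↦ w :=
    Filter.eventuallyEq_of_mem ((isOpen_chartCore P).mem_nhds hz)
      fun z hz ↦ chartRep_constField hz w
  rw [this.fderiv_eq]
  simp

/-- The Christoffel symbols of a connection in the chart at `P`: `christoffel cov P z u w` is
`∇_u w` at the point with coordinates `z`, for the constant fields `u` and `w`. -/
def christoffel (cov : Connection E M) (P : M) (z : E) : E →L[ℝ] E →L[ℝ] E :=
  (LinearMap.toContinuousLinearMap.toLinearMap ∘ₗ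
    LinearMap.mk₂ ℝ (fun u w ↦ toChart P ((chartAt E P).symm z)
      (cov (constField P w) ((chartAt E P).symm z) (ofChart P ((chartAt E P).symm z) u)))
      (fun u u' w ↦ by simp) (fun a u w ↦ by simp)
      (fun u w w' ↦ by
        rw [constField, map_add, extendField_add,
          cov_add cov (extendField_smooth _) (extendField_smooth _)]
        simp [constField])
      (fun a u w ↦ by
        rw [constField, map_smul, extendField_smul,
          cov_smul cov (extendField_smooth _) contMDiff_const]
        simp [constField, mvfderiv])).toContinuousLinearMap

theorem christoffel_apply (cov : Connection E M) (P : M) (z u w : E) :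
    christoffel cov P z u w = toChart P ((chartAt E P).symm z)
      (cov (constField P w) ((chartAt E P).symm z) (ofChart P ((chartAt E P).symm z) u)) := rfl

variable {cov : Connection E M} {P x : M} {W X Y Z : Π x : M, TangentSpace 𝓘(ℝ, E) x}

theorem contDiffOn_christoffel (hcov : IsSmoothConnection cov) (P : M) :
    ContDiffOn ℝ ∞ (christoffel cov P) (chartCore P) := by
  refine contDiffOn_clm_apply.2 fun u ↦ contDiffOn_clm_apply.2 fun w ↦ ?_
  refine ((contDiffOn_chartRep P ((constField_smooth P u).cov hcov (constField_smooth P w))).mono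
    (chartCore_subset_target P)).congr fun z hz ↦ ?_
  have ht := chartCore_subset_target P hz
  have hs := (chartAt E P).map_target ht
  rw [christoffel_apply, chartRep, constField_apply hs
    (by rwa [(chartAt E P).right_inv ht])]

theorem chartRep_smul (P : M) (f : M → ℝ) (X : Π x : M, TangentSpace 𝓘(ℝ, E) x) :
    chartRep P (f • X) = (f ∘ (chartAt E P).symm) • chartRep P X := by
  ext z
  simp [chartRep]

/-- The formula `∇_u Y = D Y u + Γ u Y` in the chart at `P`. -/
theorem toChart_cov (hx : x ∈ (chartAt E P).source) (hxc : chartAt E P x ∈ chartCore P)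
    (hY : MDiffAt (T% Y) x) (u : TangentSpace 𝓘(ℝ, E) x) :
    toChart P x (cov Y x u) = fderiv ℝ (chartRep P Y) (chartAt E P x) (toChart P x u) +
      christoffel cov P (chartAt E P x) (toChart P x u) (toChart P x (Y x)) := by
  -- the difference of `∇_u` and the coordinate derivative is tensorial, hence can be computed
  -- on constant fields
  have hten : TensorialAt 𝓘(ℝ, E) E (V := (TangentSpace 𝓘(ℝ, E) : M → Type _))
      (fun Y ↦ toChart P x (cov Y x u) -
        fderiv ℝ (chartRep P Y) (chartAt E P x) (toChart P x u)) x := by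
    constructor
    · intro f σ hf hσ
      have h1 := cov.isCovariantDerivativeOnUniv.leibniz hσ hf
      have h2 := (mdifferentiableAt_comp_chartAt_symm hx hf).hasFDerivAt.smul
        (differentiableAt_chartRep hx hσ).hasFDerivAt
      have h3 := mvfderiv_eq_fderiv_chart hx hf u
      rw [h1, chartRep_smul, h2.fderiv, chartRep_chartAt hx]
      simp only [add_apply, smul_apply, ContinuousLinearMap.smulRight_apply, map_add, map_smul,
        Function.comp_apply, (chartAt E P).left_inv hx]
      rw [h3]
      module
    · intro σ σ' hσ hσ'
      have h1 := cov.isCovariantDerivativeOnUniv.add hσ hσ'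
      have h2 := (differentiableAt_chartRep hx hσ).hasFDerivAt.add
        (differentiableAt_chartRep hx hσ').hasFDerivAt
      have h3 : chartRep P (σ + σ') = chartRep P σ + chartRep P σ' := by
        ext z; simp [chartRep]
      rw [h1, h3, h2.fderiv]
      simp only [add_apply, map_add]
      abel
  have hC := constField_smooth P (toChart P x (Y x))
  have key := hten.pointwise hY (hC.mdifferentiableAt x) (by
    rw [constField_apply hx hxc, ofChart_toChart hx])
  beta_reduce at key
  rw [fderiv_chartRep_constField hxc, zero_apply, sub_zero, sub_eq_iff_eq_add] at key
  rw [key, add_comm, christoffel_apply, (chartAt E P).left_inv hx, ofChart_toChart hx]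

theorem chartRep_cov {z : E} (hz : z ∈ chartCore P) (hY : IsSmoothField Y)
    (X : Π x : M, TangentSpace 𝓘(ℝ, E) x) :
    chartRep P (fun x ↦ cov Y x (X x)) z = fderiv ℝ (chartRep P Y) z (chartRep P X z) +
      christoffel cov P z (chartRep P X z) (chartRep P Y z) := by
  have ht := chartCore_subset_target P hz
  have hs := (chartAt E P).map_target ht
  have := toChart_cov (cov := cov) hs (by rwa [(chartAt E P).right_inv ht])
    (hY.mdifferentiableAt _) (X ((chartAt E P).symm z))
  rwa [(chartAt E P).right_inv ht] at this

theorem IsTorsionFree.cov_sub_cov (htor : IsTorsionFree cov) (hX : IsSmoothField X)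
    (hY : IsSmoothField Y) (x : M) :
    cov Y x (X x) - cov X x (Y x) = mlieBracket 𝓘(ℝ, E) X Y x := by
  have : CompleteSpace E := FiniteDimensional.complete ℝ E
  exact cov.torsion_eq_zero_iff.1 htor (hX.mdifferentiableAt x) (hY.mdifferentiableAt x)

/-- For a torsion-free connection, the Lie bracket in the curvature operator can be replaced by
covariant derivatives, whose smoothness is part of the hypotheses. -/
theorem IsTorsionFree.isSmoothField_curvatureField (htor : IsTorsionFree cov)
    (hcov : IsSmoothConnection cov) (hX : IsSmoothField X) (hY : IsSmoothField Y)
    (hZ : IsSmoothField Z) : IsSmoothField (curvatureField cov X Y Z) := by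
  have h : curvatureField cov X Y Z = fun x ↦
      cov (fun y ↦ cov Z y (Y y)) x (X x) - cov (fun y ↦ cov Z y (X y)) x (Y x) -
        (cov Z x (cov Y x (X x)) - cov Z x (cov X x (Y x))) := by
    ext x
    rw [curvatureField, ← htor.cov_sub_cov hX hY, map_sub]
  rw [h]
  exact ((hX.cov hcov (hY.cov hcov hZ)).sub_section (hY.cov hcov (hX.cov hcov hZ))).sub_section
    (((hX.cov hcov hY).cov hcov hZ).sub_section ((hY.cov hcov hX).cov hcov hZ))

theorem IsTorsionFree.christoffel_symm (htor : IsTorsionFree cov) {z : E} (hz : z ∈ chartCore P)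
    (u v : E) : christoffel cov P z u v = christoffel cov P z v u := by
  have ht := chartCore_subset_target P hz
  have hs := (chartAt E P).map_target ht
  have hr := (chartAt E P).right_inv ht
  have key := htor.cov_sub_cov (constField_smooth P u) (constField_smooth P v)
    ((chartAt E P).symm z)
  have h2 := chartRep_mlieBracket hs ((constField_smooth P u).mdifferentiableAt _)
    ((constField_smooth P v).mdifferentiableAt _)
  rw [hr, fderiv_chartRep_constField hz, fderiv_chartRep_constField hz, zero_apply, zero_apply,
    sub_zero, ← key, map_sub, constField_apply hs (by rwa [hr]), constField_apply hs (by rwa [hr]),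
    ← christoffel_apply, ← christoffel_apply] at h2
  exact sub_eq_zero.1 h2

theorem christoffel_differentiableAt (hcov : IsSmoothConnection cov) {z : E}
    (hz : z ∈ chartCore P) : DifferentiableAt ℝ (christoffel cov P) z :=
  ((contDiffOn_christoffel hcov P).contDiffAt
    ((isOpen_chartCore P).mem_nhds hz)).differentiableAt (by simp)

/-- The second covariant derivative `∇_X ∇_Y Z` in the chart at `P`. -/
theorem toChart_cov_cov (hcov : IsSmoothConnection cov) (hx : x ∈ (chartAt E P).source)
    (hxc : chartAt E P x ∈ chartCore P) (X : Π x : M, TangentSpace 𝓘(ℝ, E) x)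
    (hY : IsSmoothField Y) (hZ : IsSmoothField Z) {z a b c : E} (hz : chartAt E P x = z)
    (ha : toChart P x (X x) = a) (hb : toChart P x (Y x) = b) (hc : toChart P x (Z x) = c) :
    toChart P x (cov (fun y ↦ cov Z y (Y y)) x (X x)) =
      fderiv ℝ (fderiv ℝ (chartRep P Z)) z a b + fderiv ℝ (chartRep P Z) z
        (fderiv ℝ (chartRep P Y) z a) + fderiv ℝ (christoffel cov P) z a b c +
      christoffel cov P z (fderiv ℝ (chartRep P Y) z a) c +
      christoffel cov P z b (fderiv ℝ (chartRep P Z) z a) +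
      christoffel cov P z a (fderiv ℝ (chartRep P Z) z b + christoffel cov P z b c) := by
  have hYd := (contDiffAt_chartRep hx hY).differentiableAt (by simp)
  have hZd := (contDiffAt_chartRep hx hZ).differentiableAt (by simp)
  have hZdd := ((contDiffAt_chartRep hx hZ).fderiv_right (m := 1)
    (by rw [one_add_one_eq_two]; exact ENat.LEInfty.out)).differentiableAt
    (by simp)
  have hΓ := christoffel_differentiableAt hcov hxc
  have hev : chartRep P (fun y ↦ cov Z y (Y y)) =ᶠ[𝓝 (chartAt E P x)] fun z ↦
      fderiv ℝ (chartRep P Z) z (chartRep P Y z) +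
        christoffel cov P z (chartRep P Y z) (chartRep P Z z) :=
    Filter.eventuallyEq_of_mem ((isOpen_chartCore P).mem_nhds hxc)
      fun z hz ↦ chartRep_cov hz hZ Y
  have hd := (hZdd.hasFDerivAt.clm_apply hYd.hasFDerivAt).add
    ((hΓ.hasFDerivAt.clm_apply hYd.hasFDerivAt).clm_apply hZd.hasFDerivAt)
  have h1 := toChart_cov (cov := cov) hx hxc ((hY.cov hcov hZ).mdifferentiableAt x) (X x)
  have hsv : toChart P x (cov Z x (Y x)) = _ := toChart_cov hx hxc (hZ.mdifferentiableAt x) (Y x)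
  have hd' : fderiv ℝ (chartRep P (fun y ↦ cov Z y (Y y))) (chartAt E P x) = _ :=
    hev.fderiv_eq.trans hd.fderiv
  rw [hd', hsv] at h1
  rw [h1]
  subst hz ha hb hc
  simp only [chartRep_chartAt hx, add_apply, ContinuousLinearMap.comp_apply,
    ContinuousLinearMap.flip_apply]
  module

/-- The curvature of the connection in the chart at `P` is that of its Christoffel symbols. -/
theorem toChart_curvatureField (hcov : IsSmoothConnection cov) (hx : x ∈ (chartAt E P).source)
    (hxc : chartAt E P x ∈ chartCore P) (hX : IsSmoothField X) (hY : IsSmoothField Y)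
    (hZ : IsSmoothField Z) :
    toChart P x (curvatureField cov X Y Z x) = christoffelCurvature (christoffel cov P)
      (chartAt E P x) (toChart P x (X x)) (toChart P x (Y x)) (toChart P x (Z x)) := by
  have h1 := toChart_cov_cov hcov hx hxc X hY hZ rfl rfl rfl rfl
  have h2 := toChart_cov_cov hcov hx hxc Y hX hZ rfl rfl rfl rfl
  have h3 := toChart_cov (cov := cov) hx hxc (hZ.mdifferentiableAt x) (mlieBracket 𝓘(ℝ, E) X Y x)
  have h4 := chartRep_mlieBracket hx (hX.mdifferentiableAt x) (hY.mdifferentiableAt x)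
  have h5 := ((contDiffAt_chartRep hx hZ).isSymmSndFDerivAt (by
    simp only [minSmoothness_of_isRCLikeNormedField]; exact ENat.LEInfty.out)).eq
    (toChart P x (X x)) (toChart P x (Y x))
  rw [h4] at h3
  rw [curvatureField, map_sub, map_sub, h1, h2, h3, christoffelCurvature_apply]
  simp only [map_add, map_sub, sub_apply, h5]
  module

theorem toChart_curvature (hcov : IsSmoothConnection cov) (hx : x ∈ (chartAt E P).source)
    (hxc : chartAt E P x ∈ chartCore P) (u v w : TangentSpace 𝓘(ℝ, E) x) :
    toChart P x (curvature hcov x u v w) = christoffelCurvature (christoffel cov P)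
      (chartAt E P x) (toChart P x u) (toChart P x v) (toChart P x w) := by
  have := toChart_curvatureField hcov hx hxc (extendField_smooth u) (extendField_smooth v)
    (extendField_smooth w)
  rwa [extendField_self, extendField_self, extendField_self] at this

/-- In the chart at `P`, a locally symmetric torsion-free connection has symmetric Christoffel
symbols with parallel curvature. -/
theorem isSymmetricChristoffel_christoffel (hcov : IsSmoothConnection cov)
    (htor : IsTorsionFree cov) (hsymm : IsLocallySymmetric cov) (P : M) :
    IsSymmetricChristoffel (christoffel cov P) (chartCore P) where
  isOpen := isOpen_chartCore P
  contDiffOn := contDiffOn_christoffel hcov P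
  symm z hz u v := htor.christoffel_symm hz u v
  parallel z hz a u v w := by
    have ht := chartCore_subset_target P hz
    have hs := (chartAt E P).map_target ht
    have hr := (chartAt E P).right_inv ht
    have hxc : chartAt E P ((chartAt E P).symm z) ∈ chartCore P := by rwa [hr]
    have sm := constField_smooth (E := E) P
    have hrep : ∀ w, toChart P ((chartAt E P).symm z)
        (constField P w ((chartAt E P).symm z)) = w := fun w ↦ chartRep_constField hz w
    have hcc : ∀ a u, toChart P ((chartAt E P).symm z) (cov (constField P u)
        ((chartAt E P).symm z) (constField P a ((chartAt E P).symm z))) =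
          christoffel cov P z a u := fun a u ↦ by
      have := toChart_cov (cov := cov) hs hxc ((sm u).mdifferentiableAt _)
        (constField P a ((chartAt E P).symm z))
      rw [this, hr, hrep, hrep, fderiv_chartRep_constField hz, zero_apply, zero_add]
    have key := congrArg (toChart P ((chartAt E P).symm z))
      (hsymm (constField P a) (constField P u) (constField P v) (constField P w) (sm a) (sm u)
        (sm v) (sm w) ((chartAt E P).symm z))
    have hev : chartRep P (curvatureField cov (constField P u) (constField P v) (constField P w))
        =ᶠ[𝓝 z] fun z ↦ christoffelCurvature (christoffel cov P) z u v w := by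
      refine Filter.eventuallyEq_of_mem ((isOpen_chartCore P).mem_nhds hz) fun y hy ↦ ?_
      have ht' := chartCore_subset_target P hy
      have hr' := (chartAt E P).right_inv ht'
      have hrep' : ∀ w, toChart P ((chartAt E P).symm y)
        (constField P w ((chartAt E P).symm y)) = w := fun w ↦ chartRep_constField hy w
      have := toChart_curvatureField hcov ((chartAt E P).map_target ht') (by rwa [hr'])
        (sm u) (sm v) (sm w)
      rw [hr', hrep', hrep', hrep'] at this
      exact this
    have hRd : HasFDerivAt (christoffelCurvature (christoffel cov P))
        (fderiv ℝ (christoffelCurvature (christoffel cov P)) z) z :=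
      (((contDiffOn_christoffelCurvature (isOpen_chartCore P)
        (contDiffOn_christoffel hcov P)).contDiffAt
          ((isOpen_chartCore P).mem_nhds hz)).differentiableAt (by simp)).hasFDerivAt
    have c (w : E) := hasFDerivAt_const (𝕜 := ℝ) w z
    have hd := ((hRd.clm_apply (c u)).clm_apply (c v)).clm_apply (c w)
    have hd' := hev.fderiv_eq.trans hd.fderiv
    have t1 := toChart_cov (cov := cov) hs hxc
      ((htor.isSmoothField_curvatureField hcov (sm u) (sm v) (sm w)).mdifferentiableAt _)
      (constField P a ((chartAt E P).symm z))
    rw [toChart_curvatureField hcov hs hxc (sm u) (sm v) (sm w)] at t1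
    have t2 := toChart_curvatureField hcov hs hxc ((sm a).cov hcov (sm u)) (sm v) (sm w)
    have t3 := toChart_curvatureField hcov hs hxc (sm u) ((sm a).cov hcov (sm v)) (sm w)
    have t4 := toChart_curvatureField hcov hs hxc (sm u) (sm v) ((sm a).cov hcov (sm w))
    simp only [hr, hrep, hcc, hd'] at t1 t2 t3 t4
    simp only [map_sub, map_zero, t1, t2, t3, t4] at key
    simpa using key

end ChristoffelOfConnection

/-! ### Affine local diffeomorphisms -/

section AffineMorphism

variable {E : Type*} [NormedAddCommGroup E] [NormedSpace ℝ E] [FiniteDimensional ℝ E]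

/-- A local diffeomorphism of `E`, from an open subset of `V₁` onto an open subset of `V₂`, which
satisfies the equation `D²ψ(h, k) = Dψ(Γ₁(h, k)) - Γ₂(Dψ h, Dψ k)` of affine maps between
connections with Christoffel symbols `Γ₁` and `Γ₂`. -/
structure IsCoordinateAffine (Γ₁ Γ₂ : E → E →L[ℝ] E →L[ℝ] E) (V₁ V₂ : Set E)
    (ψ : OpenPartialHomeomorph E E) : Prop where
  source_subset : ψ.source ⊆ V₁
  target_subset : ψ.target ⊆ V₂
  contDiffOn : ContDiffOn ℝ ∞ ψ ψ.source
  contDiffOn_symm : ContDiffOn ℝ ∞ ψ.symm ψ.target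
  exists_equiv : ∀ z ∈ ψ.source, ∃ e : E ≃L[ℝ] E, fderiv ℝ ψ z = (e : E →L[ℝ] E)
  equation : ∀ z ∈ ψ.source, ∀ h k, fderiv ℝ (fderiv ℝ ψ) z h k =
    fderiv ℝ ψ z (Γ₁ z h k) - Γ₂ (ψ z) (fderiv ℝ ψ z h) (fderiv ℝ ψ z k)

/-- A linear isomorphism which intertwines the curvatures at `p` and `q` integrates to a local
diffeomorphism from `p` to `q` which is affine in coordinates. -/
theorem exists_isCoordinateAffine {Γ₁ Γ₂ : E → E →L[ℝ] E →L[ℝ] E} {V₁ V₂ : Set E}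
    (h₁ : IsSymmetricChristoffel Γ₁ V₁) (h₂ : IsSymmetricChristoffel Γ₂ V₂) {p q : E}
    (hp : p ∈ V₁) (hq : q ∈ V₂) {A₀ : E ≃L[ℝ] E}
    (hA₀ : ∀ u v w, A₀ (christoffelCurvature Γ₁ p u v w) =
      christoffelCurvature Γ₂ q (A₀ u) (A₀ v) (A₀ w)) :
    ∃ ψ : OpenPartialHomeomorph E E, p ∈ ψ.source ∧ ψ p = q ∧
      IsCoordinateAffine Γ₁ Γ₂ V₁ V₂ ψ := by
  have : CompleteSpace E := FiniteDimensional.complete ℝ E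
  obtain ⟨ε, hε, φ, A, hφp, hAp, hφ, H⟩ := exists_affine_map h₁ h₂ hp hq
    (A₀ := (A₀ : E →L[ℝ] E)) hA₀
  set B := Metric.ball p ε
  have hpB : p ∈ B := Metric.mem_ball_self hε
  have hBo : IsOpen B := Metric.isOpen_ball
  have hA : ∀ z ∈ B, fderiv ℝ φ z = A z := fun z hz ↦ (H z hz).2.2.1.fderiv
  have hcd : ∀ z ∈ B, ContDiffAt ℝ ∞ φ z := fun z hz ↦ hφ.contDiffAt (hBo.mem_nhds hz)
  have hder : HasFDerivAt φ (A₀ : E →L[ℝ] E) p := hAp ▸ (H p hpB).2.2.1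
  set ψ₀ := (hcd p hpB).toOpenPartialHomeomorph φ hder (by simp)
  set S := B ∩ A ⁻¹' (Set.range ((↑) : (E ≃L[ℝ] E) → E →L[ℝ] E)) with hS
  have hSo : IsOpen S := by
    refine ContinuousOn.isOpen_inter_preimage (fun z hz ↦ ?_) hBo ContinuousLinearEquiv.isOpen
    obtain ⟨A', hA', -⟩ := (H z hz).2.2.2
    exact hA'.continuousAt.continuousWithinAt
  set ψ := ψ₀.restrOpen S hSo
  have hψ : (ψ : E → E) = φ := rfl
  have hsrc : ∀ z ∈ ψ.source, z ∈ B ∧ A z ∈ Set.range ((↑) : (E ≃L[ℝ] E) → E →L[ℝ] E) :=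
    fun z hz ↦ hz.2
  have hequiv : ∀ z ∈ ψ.source, ∃ e : E ≃L[ℝ] E, fderiv ℝ ψ z = (e : E →L[ℝ] E) := fun z hz ↦ by
    obtain ⟨hzB, e, he⟩ := hsrc z hz
    exact ⟨e, (hA z hzB).trans he.symm⟩
  have htar : ∀ y ∈ ψ.target, ψ.symm y ∈ ψ.source := fun y hy ↦ ψ.map_target hy
  refine ⟨ψ, ⟨(hcd p hpB).mem_toOpenPartialHomeomorph_source hder (by simp), hpB, A₀, hAp.symm⟩, hφp,
    fun z hz ↦ (H z (hsrc z hz).1).1, fun y hy ↦ ?_,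
    fun z hz ↦ (hcd z (hsrc z hz).1).contDiffWithinAt, fun y hy ↦ ?_, hequiv, fun z hz h k ↦ ?_⟩
  · have := (H _ (hsrc _ (htar y hy)).1).2.1
    rwa [← hψ, ψ.right_inv hy] at this
  · obtain ⟨e, he⟩ := hequiv _ (htar y hy)
    have hc := hcd _ (hsrc _ (htar y hy)).1
    refine (ψ.contDiffAt_symm hy (f₀' := e) ?_ hc).contDiffWithinAt
    rw [← he]
    exact (hc.differentiableAt (by simp)).hasFDerivAt
  · have hz := (hsrc z hz).1
    obtain ⟨-, -, -, A', hA', heq⟩ := H z hz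
    have hev : fderiv ℝ φ =ᶠ[𝓝 z] A := Filter.eventuallyEq_of_mem (hBo.mem_nhds hz) hA
    rw [hψ, hev.fderiv_eq, hA'.fderiv, heq, hA z hz]

variable {M : Type*} [TopologicalSpace M] [T2Space M] [ChartedSpace E M] [IsManifold 𝓘(ℝ, E) ∞ M]
variable {cov : Connection E M} {P Q x : M}

theorem hasMFDerivAt_chartAt (hx : x ∈ (chartAt E P).source) :
    HasMFDerivAt 𝓘(ℝ, E) 𝓘(ℝ, E) (chartAt E P) x (toChart P x) := by
  rw [toChart_eq_mfderiv hx]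
  exact ((contMDiffAt_chartAt_coe hx).mdifferentiableAt (by simp)).hasMFDerivAt

theorem hasMFDerivAt_chartAt_symm {z : E} (hz : z ∈ (chartAt E P).target) :
    HasMFDerivAt 𝓘(ℝ, E) 𝓘(ℝ, E) (chartAt E P).symm z
      (ofChart (E := E) P ((chartAt E P).symm z)) := by
  have := ofChart_eq_mfderiv ((chartAt E P).map_target hz)
  rw [(chartAt E P).right_inv hz] at this
  rw [this]
  exact ((contMDiffAt_chartAt_symm hz).mdifferentiableAt (by simp)).hasMFDerivAt

variable (P Q) in
/-- A local homeomorphism of `E`, transported to `M` by the charts at `P` and `Q`. -/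
def chartConj (ψ : OpenPartialHomeomorph E E) : OpenPartialHomeomorph M M :=
  (chartAt E P) ≫ₕ ψ ≫ₕ (chartAt E Q).symm

theorem chartConj_apply (ψ : OpenPartialHomeomorph E E) (x : M) :
    chartConj P Q ψ x = (chartAt E Q).symm (ψ (chartAt E P x)) := rfl

variable {ψ : OpenPartialHomeomorph E E} {Γ₁ Γ₂ : E → E →L[ℝ] E →L[ℝ] E}

theorem mem_chartConj_source : x ∈ (chartConj P Q ψ).source ↔ x ∈ (chartAt E P).source ∧
    chartAt E P x ∈ ψ.source ∧ ψ (chartAt E P x) ∈ (chartAt E Q).target := by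
  simp [chartConj]

theorem mem_chartConj_target : x ∈ (chartConj P Q ψ).target ↔ x ∈ (chartAt E Q).source ∧
    chartAt E Q x ∈ ψ.target ∧ ψ.symm (chartAt E Q x) ∈ (chartAt E P).target := by
  simp [chartConj, and_assoc]

theorem contMDiffOn_chartConj (hψ : ContDiffOn ℝ ∞ ψ ψ.source) :
    ContMDiffOn 𝓘(ℝ, E) 𝓘(ℝ, E) ∞ (chartConj P Q ψ) (chartConj P Q ψ).source := by
  intro x hx
  obtain ⟨h1, h2, h3⟩ := mem_chartConj_source.1 hx
  have a := contMDiffAt_chartAt_coe h1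
  have b := (hψ.contDiffAt (ψ.open_source.mem_nhds h2)).contMDiffAt
  have c := contMDiffAt_chartAt_symm h3
  exact (c.comp x (b.comp x a)).contMDiffWithinAt

theorem contMDiffOn_chartConj_symm (hψ : ContDiffOn ℝ ∞ ψ.symm ψ.target) :
    ContMDiffOn 𝓘(ℝ, E) 𝓘(ℝ, E) ∞ (chartConj P Q ψ).symm (chartConj P Q ψ).target := by
  intro x hx
  obtain ⟨h1, h2, h3⟩ := mem_chartConj_target.1 hx
  have a := contMDiffAt_chartAt_coe h1
  have b := (hψ.contDiffAt (ψ.open_target.mem_nhds h2)).contMDiffAt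
  have c := contMDiffAt_chartAt_symm h3
  exact (c.comp x (b.comp x a)).contMDiffWithinAt

theorem mfderiv_chartConj (hx : x ∈ (chartConj P Q ψ).source)
    (hψ : DifferentiableAt ℝ ψ (chartAt E P x)) :
    mfderiv 𝓘(ℝ, E) 𝓘(ℝ, E) (chartConj P Q ψ) x =
      (ofChart Q (chartConj P Q ψ x)).comp ((fderiv ℝ ψ (chartAt E P x)).comp (toChart P x)) := by
  obtain ⟨h1, h2, h3⟩ := mem_chartConj_source.1 hx
  exact ((hasMFDerivAt_chartAt_symm h3).comp x
    (hψ.hasFDerivAt.hasMFDerivAt.comp x (hasMFDerivAt_chartAt h1))).mfderiv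

theorem chartConj_mem (hx : x ∈ (chartConj P Q ψ).source) :
    chartConj P Q ψ x ∈ (chartAt E Q).source :=
  (mem_chartConj_target.1 ((chartConj P Q ψ).map_source hx)).1

theorem chartAt_chartConj (hx : x ∈ (chartConj P Q ψ).source) :
    chartAt E Q (chartConj P Q ψ x) = ψ (chartAt E P x) :=
  (chartAt E Q).right_inv (mem_chartConj_source.1 hx).2.2

/-- The derivative of a transported local diffeomorphism, as a continuous linear equivalence. -/
theorem exists_equiv_mfderiv_chartConj {V₁ V₂ : Set E} (h : IsCoordinateAffine Γ₁ Γ₂ V₁ V₂ ψ)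
    (hx : x ∈ (chartConj P Q ψ).source) :
    ∃ L : TangentSpace 𝓘(ℝ, E) x ≃L[ℝ] TangentSpace 𝓘(ℝ, E) (chartConj P Q ψ x),
      (L : _ →L[ℝ] _) = mfderiv 𝓘(ℝ, E) 𝓘(ℝ, E) (chartConj P Q ψ) x ∧
      ∀ v, fderiv ℝ ψ (chartAt E P x) (toChart P x (L.symm v)) =
        toChart Q (chartConj P Q ψ x) v := by
  obtain ⟨h1, h2, h3⟩ := mem_chartConj_source.1 hx
  obtain ⟨e, he⟩ := h.exists_equiv _ h2
  have hm := mfderiv_chartConj hx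
    ((h.contDiffOn.contDiffAt (ψ.open_source.mem_nhds h2)).differentiableAt (by simp))
  have hy := chartConj_mem hx
  refine ⟨ContinuousLinearEquiv.equivOfInverse
    (mfderiv 𝓘(ℝ, E) 𝓘(ℝ, E) (chartConj P Q ψ) x)
    ((ofChart P x).comp ((e.symm : E →L[ℝ] E).comp (toChart Q (chartConj P Q ψ x))))
    (fun v ↦ ?_) (fun v ↦ ?_), rfl, fun v ↦ ?_⟩
  · rw [hm, he]
    simp [toChart_ofChart hy, ofChart_toChart h1]
  · rw [hm, he]
    simp [toChart_ofChart h1, ofChart_toChart hy]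
  · refine (congrArg (fun L : E →L[ℝ] E ↦ L _) he).trans ?_
    change e (toChart P x (ofChart P x (e.symm (toChart Q (chartConj P Q ψ x) v)))) = _
    rw [toChart_ofChart h1, e.apply_symm_apply]

/-- A local diffeomorphism which satisfies the equation of affine maps in charts is affine. -/
theorem isLocalAffineMorphism_chartConj
    (h : IsCoordinateAffine (christoffel cov P) (christoffel cov Q) (chartCore P) (chartCore Q) ψ) :
    IsLocalAffineMorphism cov (chartConj P Q ψ) := by
  refine ⟨contMDiffOn_chartConj h.contDiffOn, contMDiffOn_chartConj_symm h.contDiffOn_symm,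
    fun x hx Y hY u ↦ ?_⟩
  have : CompleteSpace E := FiniteDimensional.complete ℝ E
  obtain ⟨h1, h2, h3⟩ := mem_chartConj_source.1 hx
  set Φ := chartConj P Q ψ
  set z := chartAt E P x with hz
  have hy : Φ x ∈ (chartAt E Q).source := chartConj_mem hx
  have hyz : chartAt E Q (Φ x) = ψ z := chartAt_chartConj hx
  have hcore : ψ z ∈ chartCore Q := h.target_subset (ψ.map_source h2)
  have hψ : ContDiffAt ℝ ∞ ψ z := h.contDiffOn.contDiffAt (ψ.open_source.mem_nhds h2)
  have hψ' : DifferentiableAt ℝ (fderiv ℝ ψ) z := (hψ.fderiv_right (m := 1)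
    (by rw [one_add_one_eq_two]; exact ENat.LEInfty.out)).differentiableAt (by simp)
  have hm := mfderiv_chartConj hx (hψ.differentiableAt (by simp))
  have htoQ : ∀ v, toChart Q (Φ x) (mfderiv 𝓘(ℝ, E) 𝓘(ℝ, E) Φ x v) =
      fderiv ℝ ψ z (toChart P x v) := fun v ↦ by
    rw [hm]
    exact toChart_ofChart hy _
  set Z := mpullback 𝓘(ℝ, E) 𝓘(ℝ, E) Φ Y
  -- in charts, the pulled back field `Z` is characterized by `Dψ Z = Y ∘ ψ`
  have hZ : ∀ y ∈ Φ.source, fderiv ℝ ψ (chartAt E P y) (toChart P y (Z y)) =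
      toChart Q (Φ y) (Y (Φ y)) := fun y hy ↦ by
    obtain ⟨L, hL, hL'⟩ := exists_equiv_mfderiv_chartConj h hy
    have : Z y = L.symm (Y (Φ y)) := by
      change (mfderiv 𝓘(ℝ, E) 𝓘(ℝ, E) Φ y).inverse (Y (Φ y)) = _
      rw [← hL, ContinuousLinearMap.inverse_equiv]
      rfl
    rw [this, hL']
  have hZd : MDiffAt (T% Z) x := by
    obtain ⟨L, hL, -⟩ := exists_equiv_mfderiv_chartConj h hx
    have : IsManifold 𝓘(ℝ, E) 2 M := IsManifold.of_le (n := ∞) ENat.LEInfty.out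
    exact MDifferentiableAt.mpullback_vectorField (n := ∞) hY
      ((contMDiffOn_chartConj h.contDiffOn).contMDiffAt (Φ.open_source.mem_nhds hx))
      ⟨L, hL⟩ ENat.LEInfty.out
  have hev : (fun z ↦ fderiv ℝ ψ z (chartRep P Z z)) =ᶠ[𝓝 z] chartRep Q Y ∘ ψ := by
    have : ∀ᶠ z' in 𝓝 z, (chartAt E P).symm z' ∈ Φ.source := by
      have hc := (chartAt E P).symm.continuousAt ((chartAt E P).map_source h1)
      exact hc.eventually_mem (Φ.open_source.mem_nhds (by
        rwa [(chartAt E P).left_inv h1]))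
    filter_upwards [this, (chartAt E P).open_target.mem_nhds ((chartAt E P).map_source h1)]
      with z' hz' ht
    have := hZ _ hz'
    have hr := (chartAt E P).right_inv ht
    rw [hr] at this
    refine this.trans ?_
    have : Φ ((chartAt E P).symm z') = (chartAt E Q).symm (ψ z') := by
      rw [chartConj_apply, hr]
    rw [this]
    rfl
  have hZr := differentiableAt_chartRep h1 hZd
  have hYr := differentiableAt_chartRep hy hY
  rw [hyz] at hYr
  have hd := congrArg (fun L : E →L[ℝ] E ↦ L (toChart P x u))
    (((hψ'.hasFDerivAt.clm_apply hZr.hasFDerivAt).fderiv.symm.trans hev.fderiv_eq).trans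
      (hYr.hasFDerivAt.comp z (hψ.differentiableAt (by simp)).hasFDerivAt).fderiv)
  simp only [add_apply, ContinuousLinearMap.comp_apply, ContinuousLinearMap.flip_apply] at hd
  rw [h.equation z h2, chartRep_chartAt h1, hZ x hx] at hd
  have t1 := toChart_cov (cov := cov) h1 (h.source_subset h2) hZd u
  have t2 := toChart_cov (cov := cov) hy (by rwa [hyz]) hY
    (mfderiv 𝓘(ℝ, E) 𝓘(ℝ, E) Φ x u)
  have t3 := htoQ (cov Z x u)
  rw [htoQ, hyz] at t2
  rw [t1, map_add] at t3
  apply (chartEquiv hy).injective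
  refine t3.trans (Eq.trans ?_ t2.symm)
  rw [← hd]
  abel

end AffineMorphism

/-! ### Local affine homogeneity -/

section Homogeneity

variable {E : Type*} [NormedAddCommGroup E] [NormedSpace ℝ E] [FiniteDimensional ℝ E]
  {M : Type*} [TopologicalSpace M] [T2Space M] [ChartedSpace E M] [IsManifold 𝓘(ℝ, E) ∞ M]
  {cov : Connection E M}

/-- Two points are related if some linear isomorphism of their tangent spaces matches the
curvature tensors. -/
def SameCurvature (hcov : IsSmoothConnection cov) (P Q : M) : Prop :=
  ∃ A : TangentSpace 𝓘(ℝ, E) P ≃ₗ[ℝ] TangentSpace 𝓘(ℝ, E) Q, ∀ u v w,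
    A (curvature hcov P u v w) = curvature hcov Q (A u) (A v) (A w)

theorem SameCurvature.symm {hcov : IsSmoothConnection cov} {P Q : M}
    (h : SameCurvature hcov P Q) : SameCurvature hcov Q P := by
  obtain ⟨A, hA⟩ := h
  refine ⟨A.symm, fun u v w ↦ ?_⟩
  rw [A.symm_apply_eq, hA]
  simp

theorem SameCurvature.trans {hcov : IsSmoothConnection cov} {P Q S : M}
    (h : SameCurvature hcov P Q) (h' : SameCurvature hcov Q S) : SameCurvature hcov P S := by
  obtain ⟨A, hA⟩ := h
  obtain ⟨B, hB⟩ := h'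
  exact ⟨A.trans B, fun u v w ↦ by simp [hA, hB]⟩

/-- Parallel transport in the chart at `P` matches the curvature at `P` with that at any point
nearby. -/
theorem eventually_sameCurvature (hcov : IsSmoothConnection cov) (htor : IsTorsionFree cov)
    (hsymm : IsLocallySymmetric cov) (P : M) : ∀ᶠ Q in 𝓝 P, SameCurvature hcov P Q := by
  have hc : ContinuousAt (chartAt E P) P := (chartAt E P).continuousAt (mem_chart_source E P)
  have h1 := hc.eventually (eventually_exists_intertwining
    (isSymmetricChristoffel_christoffel hcov htor hsymm P) (mem_chartCore P))
  have h2 := hc.eventually_mem ((isOpen_chartCore P).mem_nhds (mem_chartCore P))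
  filter_upwards [h1, h2, (chartAt E P).open_source.mem_nhds (mem_chart_source E P)]
    with x ⟨A, hA⟩ hxc hx
  have hP := mem_chart_source E P
  refine ⟨(chartEquiv hP).trans (A.toLinearEquiv.trans (chartEquiv hx).symm), fun u v w ↦ ?_⟩
  apply (chartEquiv hx).injective
  have h3 := toChart_curvature hcov hP (mem_chartCore P) u v w
  have h4 := toChart_curvature hcov hx hxc (ofChart P x (A (toChart P P u)))
    (ofChart P x (A (toChart P P v))) (ofChart P x (A (toChart P P w)))
  rw [toChart_ofChart hx, toChart_ofChart hx, toChart_ofChart hx, ← hA, ← h3] at h4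
  exact (toChart_ofChart hx _).trans h4.symm

/-- By connectedness, the curvature tensors at any two points are linearly equivalent. -/
theorem sameCurvature [PreconnectedSpace M] (hcov : IsSmoothConnection cov)
    (htor : IsTorsionFree cov) (hsymm : IsLocallySymmetric cov) (P Q : M) :
    SameCurvature hcov P Q := by
  have : Std.Symm (SameCurvature hcov) := ⟨fun _ _ h ↦ h.symm⟩
  exact PreconnectedSpace.induction₂ (SameCurvature hcov)
    (eventually_sameCurvature hcov htor hsymm) ⟨fun _ _ _ h h' ↦ h.trans h'⟩ P Q

/-- A locally symmetric torsion-free connection on a connected manifold is locally affine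
homogeneous. -/
theorem isLocallyAffineHomogeneous [PreconnectedSpace M] (hcov : IsSmoothConnection cov)
    (htor : IsTorsionFree cov) (hsymm : IsLocallySymmetric cov) :
    IsLocallyAffineHomogeneous cov := by
  intro P Q
  obtain ⟨A, hA⟩ := sameCurvature hcov htor hsymm P Q
  have hP := mem_chart_source E P
  have hQ := mem_chart_source E Q
  set A₀ : E ≃L[ℝ] E := ((chartEquiv hP).symm.trans (A.trans (chartEquiv hQ))).toContinuousLinearEquiv
  have hA₀ : ∀ u v w, A₀ (christoffelCurvature (christoffel cov P) (chartAt E P P) u v w) =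
      christoffelCurvature (christoffel cov Q) (chartAt E Q Q) (A₀ u) (A₀ v) (A₀ w) := by
    intro u v w
    have h3 := toChart_curvature hcov hP (mem_chartCore P) (ofChart P P u) (ofChart P P v)
      (ofChart P P w)
    have h4 := toChart_curvature hcov hQ (mem_chartCore Q) (A (ofChart P P u))
      (A (ofChart P P v)) (A (ofChart P P w))
    rw [toChart_ofChart hP, toChart_ofChart hP, toChart_ofChart hP] at h3
    rw [← h3]
    refine Eq.trans ?_ h4
    rw [← hA]
    exact congrArg (fun y ↦ toChart Q Q (A y)) (ofChart_toChart hP _)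
  obtain ⟨ψ, hp, hpq, hψ⟩ := exists_isCoordinateAffine
    (isSymmetricChristoffel_christoffel hcov htor hsymm P)
    (isSymmetricChristoffel_christoffel hcov htor hsymm Q) (mem_chartCore P) (mem_chartCore Q) hA₀
  refine ⟨chartConj P Q ψ, mem_chartConj_source.2 ⟨hP, hp, ?_⟩, ?_,
    isLocalAffineMorphism_chartConj hψ⟩
  · rw [hpq]
    exact (chartAt E Q).map_source hQ
  · rw [chartConj_apply, hpq, (chartAt E Q).left_inv hQ]

end Homogeneity

/-! ### The Ricci tensor of Christoffel symbols -/

section ChristoffelRicci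

variable {E : Type*} [NormedAddCommGroup E] [NormedSpace ℝ E] [FiniteDimensional ℝ E]

variable (E) in
/-- The trace, as a continuous linear form on endomorphisms. -/
def traceCLM : (E →L[ℝ] E) →L[ℝ] ℝ :=
  (LinearMap.trace ℝ E ∘ₗ ContinuousLinearMap.coeLM ℝ).toContinuousLinearMap

theorem traceCLM_apply (L : E →L[ℝ] E) : traceCLM E L = LinearMap.trace ℝ E L := rfl

theorem traceCLM_comp_comm (L L' : E →L[ℝ] E) : traceCLM E (L ∘L L') = traceCLM E (L' ∘L L) :=
  LinearMap.trace_mul_comm ℝ (L : E →ₗ[ℝ] E) (L' : E →ₗ[ℝ] E)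

/-- The bilinear form `(u, v) ↦ Tr {a ↦ R(a, u) v}`. -/
def traceForm (R : E →L[ℝ] E →L[ℝ] E →L[ℝ] E) : E →L[ℝ] E →L[ℝ] ℝ :=
  ContinuousLinearMap.compL ℝ E (E →L[ℝ] E) ℝ (traceCLM E) ∘L
    ((ContinuousLinearMap.flipₗᵢ ℝ E E E).toContinuousLinearEquiv :
      (E →L[ℝ] E →L[ℝ] E) →L[ℝ] (E →L[ℝ] E →L[ℝ] E)) ∘L R.flip

theorem traceForm_apply (R : E →L[ℝ] E →L[ℝ] E →L[ℝ] E) (u v : E) :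
    traceForm R u v = traceCLM E ((R.flip u).flip v) := rfl

/-- The Leibniz rule for the Ricci tensor of Christoffel symbols with parallel curvature. -/
theorem IsSymmetricChristoffel.traceForm_fderiv {Γ : E → E →L[ℝ] E →L[ℝ] E} {V : Set E}
    (h : IsSymmetricChristoffel Γ V) {z : E} (hz : z ∈ V) (a u v : E) :
    traceCLM E (((fderiv ℝ (christoffelCurvature Γ) z a).flip u).flip v) =
      traceForm (christoffelCurvature Γ z) (Γ z a u) v +
        traceForm (christoffelCurvature Γ z) u (Γ z a v) := by
  set R := christoffelCurvature Γ z
  have key : ((fderiv ℝ (christoffelCurvature Γ) z a).flip u).flip v =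
      ((R.flip u).flip v) ∘L Γ z a - Γ z a ∘L ((R.flip u).flip v) +
        (R.flip (Γ z a u)).flip v + (R.flip u).flip (Γ z a v) := by
    ext b
    have := h.parallel z hz a b u v
    simp only [add_apply, sub_apply, ContinuousLinearMap.comp_apply,
      ContinuousLinearMap.flip_apply]
    linear_combination (norm := module) this
  -- a commutator has trace zero
  rw [key, map_add, map_add, map_sub, traceCLM_comp_comm, sub_self, zero_add]
  rfl

end ChristoffelRicci

/-! ### The Ricci tensor of a locally symmetric connection -/

section Ricci

variable {E : Type*} [NormedAddCommGroup E] [NormedSpace ℝ E] [FiniteDimensional ℝ E]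
  {M : Type*} [TopologicalSpace M] [T2Space M] [ChartedSpace E M] [IsManifold 𝓘(ℝ, E) ∞ M]
  {cov : Connection E M} {P x : M} {W X Y Z : Π x : M, TangentSpace 𝓘(ℝ, E) x}

theorem ricci_eq_traceForm (hcov : IsSmoothConnection cov) (hx : x ∈ (chartAt E P).source)
    (hxc : chartAt E P x ∈ chartCore P) (u v : TangentSpace 𝓘(ℝ, E) x) :
    ricci hcov x u v = traceForm (christoffelCurvature (christoffel cov P) (chartAt E P x))
      (toChart P x u) (toChart P x v) := by
  change LinearMap.trace ℝ (TangentSpace 𝓘(ℝ, E) x) (((curvature hcov x).flip u).flip v) = _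
  rw [← LinearMap.trace_conj' _ (chartEquiv hx), traceForm_apply, traceCLM_apply]
  congr 1
  ext a
  refine (toChart_curvature hcov hx hxc (ofChart P x a) u v).trans ?_
  rw [toChart_ofChart hx]
  rfl

/-- The function `ρ(X, Y)` in the chart at `P`. -/
theorem ricci_comp_chartAt_symm (hcov : IsSmoothConnection cov)
    (X Y : Π x : M, TangentSpace 𝓘(ℝ, E) x) {z : E} (hz : z ∈ chartCore P) :
    ((fun x ↦ ricci hcov x (X x) (Y x)) ∘ (chartAt E P).symm) z =
      traceCLM E (((christoffelCurvature (christoffel cov P) z).flip (chartRep P X z)).flip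
        (chartRep P Y z)) := by
  have ht := chartCore_subset_target P hz
  have hr := (chartAt E P).right_inv ht
  have := ricci_eq_traceForm hcov ((chartAt E P).map_target ht) (by rwa [hr])
    (X ((chartAt E P).symm z)) (Y ((chartAt E P).symm z))
  rw [hr] at this
  exact this

theorem contMDiff_ricci (hcov : IsSmoothConnection cov) (hX : IsSmoothField X)
    (hY : IsSmoothField Y) :
    ContMDiff 𝓘(ℝ, E) 𝓘(ℝ, ℝ) ∞ fun x ↦ ricci hcov x (X x) (Y x) := by
  intro P
  have hP := mem_chart_source E P
  have hopen := (isOpen_chartCore P).mem_nhds (mem_chartCore (E := E) P)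
  have hR := (contDiffOn_christoffelCurvature (isOpen_chartCore P)
    (contDiffOn_christoffel hcov P)).contDiffAt hopen
  have hflip {F : Type _} [NormedAddCommGroup F] [NormedSpace ℝ F] :
      ContDiff ℝ ∞ (ContinuousLinearMap.flip : (E →L[ℝ] E →L[ℝ] F) → (E →L[ℝ] E →L[ℝ] F)) :=
    (ContinuousLinearMap.flipₗᵢ ℝ E E F).contDiff
  have h1 := (traceCLM E).contDiff.contDiffAt.comp (n := ∞) _ ((hflip.contDiffAt.comp _
    ((hflip.contDiffAt.comp _ hR).clm_apply (contDiffAt_chartRep hP hX))).clm_apply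
      (contDiffAt_chartRep hP hY))
  refine (h1.contMDiffAt.comp P (contMDiffAt_chartAt_coe hP)).congr_of_eventuallyEq ?_
  filter_upwards [(chartAt E P).open_source.mem_nhds hP,
    ((chartAt E P).continuousAt hP).eventually_mem hopen] with x hx hxc
  have := ricci_comp_chartAt_symm hcov X Y hxc
  rw [Function.comp_apply, (chartAt E P).left_inv hx] at this
  exact this

set_option maxHeartbeats 1000000 in
/-- The Ricci tensor of a locally symmetric torsion-free connection is parallel. -/
theorem fderiv_ricci_comp_chartAt_symm (hcov : IsSmoothConnection cov) (htor : IsTorsionFree cov)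
    (hsymm : IsLocallySymmetric cov) (hX : IsSmoothField X) (hY : IsSmoothField Y)
    (u : TangentSpace 𝓘(ℝ, E) P) :
    fderiv ℝ ((fun x ↦ ricci hcov x (X x) (Y x)) ∘ (chartAt E P).symm) (chartAt E P P)
      (toChart P P u) = ricci hcov P (cov X P u) (Y P) + ricci hcov P (X P) (cov Y P u) := by
  have hP := mem_chart_source E P
  have hc := mem_chartCore (E := E) P
  have hopen := (isOpen_chartCore P).mem_nhds hc
  have hS := isSymmetricChristoffel_christoffel hcov htor hsymm P
  have hR := ((contDiffOn_christoffelCurvature (isOpen_chartCore P)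
    (contDiffOn_christoffel hcov P)).contDiffAt hopen).differentiableAt (by simp)
  have hXd := (contDiffAt_chartRep hP hX).differentiableAt (by simp)
  have hYd := (contDiffAt_chartRep hP hY).differentiableAt (by simp)
  have hev := Filter.eventuallyEq_of_mem hopen
    fun z hz ↦ ricci_comp_chartAt_symm hcov X Y hz
  have hflip {F : Type _} [NormedAddCommGroup F] [NormedSpace ℝ F] (L : E →L[ℝ] E →L[ℝ] F) :
      HasFDerivAt (ContinuousLinearMap.flip : (E →L[ℝ] E →L[ℝ] F) → (E →L[ℝ] E →L[ℝ] F))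
        ((ContinuousLinearMap.flipₗᵢ ℝ E E F).toContinuousLinearEquiv :
          (E →L[ℝ] E →L[ℝ] F) →L[ℝ] (E →L[ℝ] E →L[ℝ] F)) L :=
    ((ContinuousLinearMap.flipₗᵢ ℝ E E F).toContinuousLinearEquiv :
          (E →L[ℝ] E →L[ℝ] F) →L[ℝ] (E →L[ℝ] E →L[ℝ] F)).hasFDerivAt
  have hd := (traceCLM E).hasFDerivAt.comp _ (((hflip _).comp _
    (((hflip _).comp _ hR.hasFDerivAt).clm_apply hXd.hasFDerivAt)).clm_apply hYd.hasFDerivAt)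
  have hd' := congrArg (fun L : E →L[ℝ] ℝ ↦ L (toChart P P u)) (hev.fderiv_eq.trans hd.fderiv)
  refine hd'.trans ?_
  set a := toChart P P u
  set z := chartAt E P P
  set R := christoffelCurvature (christoffel cov P)
  have e1 := ricci_eq_traceForm hcov hP hc (cov X P u) (Y P)
  have e2 := ricci_eq_traceForm hcov hP hc (X P) (cov Y P u)
  have e3 := hS.traceForm_fderiv hc a (chartRep P X z) (chartRep P Y z)
  rw [toChart_cov hP hc (hX.mdifferentiableAt P), ← chartRep_chartAt hP (X := X),
    ← chartRep_chartAt hP (X := Y), map_add, add_apply] at e1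
  rw [toChart_cov hP hc (hY.mdifferentiableAt P), ← chartRep_chartAt hP (X := X),
    ← chartRep_chartAt hP (X := Y), map_add] at e2
  rw [e1, e2]
  have e4 : traceCLM E ((((R z).flip (chartRep P X z)).flip) (fderiv ℝ (chartRep P Y) z a) +
      (((fderiv ℝ R z a).flip (chartRep P X z)).flip (chartRep P Y z) +
        ((R z).flip (fderiv ℝ (chartRep P X) z a)).flip (chartRep P Y z))) =
      traceForm (R z) (fderiv ℝ (chartRep P X) z a) (chartRep P Y z) +
        traceForm (R z) (christoffel cov P z a (chartRep P X z)) (chartRep P Y z) +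
      (traceForm (R z) (chartRep P X z) (fderiv ℝ (chartRep P Y) z a) +
        traceForm (R z) (chartRep P X z) (christoffel cov P z a (chartRep P Y z))) := by
    rw [map_add, map_add, e3]
    simp only [traceForm_apply]
    ring
  refine Eq.trans ?_ e4
  simp only [ContinuousLinearMap.comp_apply, add_apply]
  refine congrArg (traceCLM E) ?_
  ext b
  simp [add_apply]
  abel

theorem symRicci_apply (hcov : IsSmoothConnection cov) (x : M) (u v : TangentSpace 𝓘(ℝ, E) x) :
    symRicci hcov x u v = (1 / 2 : ℝ) * (ricci hcov x u v + ricci hcov x v u) := rfl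

theorem contMDiff_symRicci (hcov : IsSmoothConnection cov) (hX : IsSmoothField X)
    (hY : IsSmoothField Y) :
    ContMDiff 𝓘(ℝ, E) 𝓘(ℝ, ℝ) ∞ fun x ↦ symRicci hcov x (X x) (Y x) := by
  have h := (contMDiff_const (c := (1 / 2 : ℝ))).mul
    ((contMDiff_ricci hcov hX hY).add (contMDiff_ricci hcov hY hX))
  simp only [symRicci_apply]
  exact h

theorem isPseudoRiemannianMetric_symRicci (hcov : IsSmoothConnection cov)
    (hnd : ∀ x : M, (symRicci hcov x).Nondegenerate) :
    IsPseudoRiemannianMetric (symRicci hcov) where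
  symm x := ⟨fun u v ↦ by rw [symRicci_apply, symRicci_apply, add_comm]⟩
  nondegenerate := hnd
  smooth _ _ hX hY := contMDiff_symRicci hcov hX hY

/-- The symmetric Ricci tensor is parallel, so the given connection is metric for it. -/
theorem isLeviCivita_symRicci (hcov : IsSmoothConnection cov) (htor : IsTorsionFree cov)
    (hsymm : IsLocallySymmetric cov) : IsLeviCivita (symRicci hcov) cov where
  smooth := hcov
  torsionFree := htor
  metric W X Y _ hX hY x := by
    have hx := mem_chart_source E x
    rw [mvfderiv_eq_fderiv_chart hx
      ((contMDiff_symRicci hcov hX hY x).mdifferentiableAt (by simp))]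
    have d1 := mdifferentiableAt_comp_chartAt_symm hx
      ((contMDiff_ricci hcov hX hY x).mdifferentiableAt (by simp))
    have d2 := mdifferentiableAt_comp_chartAt_symm hx
      ((contMDiff_ricci hcov hY hX x).mdifferentiableAt (by simp))
    have h := congrArg (fun L : E →L[ℝ] ℝ ↦ L (toChart x x (W x)))
      ((d1.hasFDerivAt.add d2.hasFDerivAt).const_mul (1 / 2 : ℝ)).fderiv
    refine h.trans ?_
    rw [smul_apply, add_apply, fderiv_ricci_comp_chartAt_symm hcov htor hsymm hX hY,
      fderiv_ricci_comp_chartAt_symm hcov htor hsymm hY hX, symRicci_apply, symRicci_apply,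
      smul_eq_mul]
    ring

end Ricci

/-! ### Uniqueness of the Levi-Civita connection -/

section LeviCivita

variable {E : Type*} [NormedAddCommGroup E] [NormedSpace ℝ E] [FiniteDimensional ℝ E]
  {M : Type*} [TopologicalSpace M] [T2Space M] [ChartedSpace E M] [IsManifold 𝓘(ℝ, E) ∞ M]
  {cov cov' : Connection E M} {X Y Z : Π x : M, TangentSpace 𝓘(ℝ, E) x}
  {g : ∀ x : M, LinearMap.BilinForm ℝ (TangentSpace 𝓘(ℝ, E) x)}

/-- A pseudo-Riemannian metric has at most one Levi-Civita connection: if `D` is the difference of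
two of them, then `g(D(X, Y), Z)` is symmetric in `X` and `Y` and antisymmetric in `Y` and `Z`. -/
theorem IsLeviCivita.eq_on_smooth (hg : IsPseudoRiemannianMetric g) (h : IsLeviCivita g cov)
    (h' : IsLeviCivita g cov') (hX : IsSmoothField X) : cov X = cov' X := by
  funext x
  set S : (Π x : M, TangentSpace 𝓘(ℝ, E) x) → (Π x : M, TangentSpace 𝓘(ℝ, E) x) →
      (Π x : M, TangentSpace 𝓘(ℝ, E) x) → ℝ :=
    fun U V W ↦ g x (cov V x (U x) - cov' V x (U x)) (W x) with hS
  have hsymm : ∀ U V W, IsSmoothField U → IsSmoothField V → S U V W = S V U W := by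
    intro U V W hU hV
    have e1 := h.torsionFree.cov_sub_cov hU hV x
    have e2 := h'.torsionFree.cov_sub_cov hU hV x
    have : cov V x (U x) - cov' V x (U x) = cov U x (V x) - cov' U x (V x) := by
      rw [← e2] at e1
      rw [sub_eq_sub_iff_add_eq_add] at e1 ⊢
      rw [e1, add_comm]
    simp only [hS, this]
  have hskew : ∀ U V W, IsSmoothField U → IsSmoothField V → IsSmoothField W →
      S U V W = - S U W V := by
    intro U V W hU hV hW
    have e1 := h.metric U V W hU hV hW x
    have e2 := h'.metric U V W hU hV hW x
    have e3 := (hg.symm x).eq (V x) (cov W x (U x))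
    have e4 := (hg.symm x).eq (V x) (cov' W x (U x))
    simp only [hS, map_sub, LinearMap.sub_apply]
    linarith
  have hzero : ∀ U V W, IsSmoothField U → IsSmoothField V → IsSmoothField W → S U V W = 0 := by
    intro U V W hU hV hW
    have := hskew U V W hU hV hW
    have := hsymm U W V hU hW
    have := hskew W U V hW hU hV
    have := hsymm W V U hW hV
    have := hskew V W U hV hW hU
    have := hsymm U V W hU hV
    linarith
  ext u
  refine sub_eq_zero.1 ((hg.nondegenerate x).1 _ fun w ↦ ?_)
  have := hzero _ X _ (extendField_smooth u) hX (extendField_smooth w)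
  simp only [hS, extendField_self] at this
  exact this

/-- Parallelism of the curvature depends only on the covariant derivatives of smooth fields. -/
theorem IsLocallySymmetric.of_eq_on_smooth (hcov : IsSmoothConnection cov)
    (htor : IsTorsionFree cov) (hsymm : IsLocallySymmetric cov)
    (h : ∀ X, IsSmoothField X → cov' X = cov X) : IsLocallySymmetric cov' := by
  have hR : ∀ X Y Z, IsSmoothField X → IsSmoothField Y → IsSmoothField Z →
      curvatureField cov' X Y Z = curvatureField cov X Y Z := by
    intro X Y Z hX hY hZ
    ext x
    simp only [curvatureField, h Z hZ, h _ (hX.cov hcov hZ), h _ (hY.cov hcov hZ)]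
  intro W X Y Z hW hX hY hZ x
  rw [h X hX, h Y hY, h Z hZ, hR X Y Z hX hY hZ, hR _ Y Z (hW.cov hcov hX) hY hZ,
    hR X _ Z hX (hW.cov hcov hY) hZ, hR X Y _ hX hY (hW.cov hcov hZ),
    h _ (htor.isSmoothField_curvatureField hcov hX hY hZ)]
  exact hsymm W X Y Z hW hX hY hZ x

end LeviCivita

end AffineGeometry

end

theorem theorem1p1 {E : Type*} [NormedAddCommGroup E] [NormedSpace ℝ E] [FiniteDimensional ℝ E]
    {M : Type*} [TopologicalSpace M] [T2Space M] [ConnectedSpace M]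
    [ChartedSpace E M] [IsManifold 𝓘(ℝ, E) ∞ M]
    (cov : AffineGeometry.Connection E M) (hcov : AffineGeometry.IsSmoothConnection cov)
    (htorsion : AffineGeometry.IsTorsionFree cov)
    (hsymm : AffineGeometry.IsLocallySymmetric cov) :
    AffineGeometry.IsLocallyAffineHomogeneous cov ∧
    ((∀ x : M, (AffineGeometry.symRicci hcov x).Nondegenerate) →
      AffineGeometry.IsLocallySymmetricMetric (AffineGeometry.symRicci hcov) ∧
      AffineGeometry.IsLeviCivita (AffineGeometry.symRicci hcov) cov) := by
  refine ⟨AffineGeometry.isLocallyAffineHomogeneous hcov htorsion hsymm, fun hnd ↦ ?_⟩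
  have hg := AffineGeometry.isPseudoRiemannianMetric_symRicci hcov hnd
  have hLC := AffineGeometry.isLeviCivita_symRicci hcov htorsion hsymm
  exact ⟨⟨hg, ⟨cov, hLC⟩, fun cov' h' ↦ hsymm.of_eq_on_smooth hcov htorsion
    fun X hX ↦ h'.eq_on_smooth hg hLC hX⟩, hLC⟩
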